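/- Let $Z$ be a set of data points, let $\ell:\mathbb{R}^d\times Z\to\mathbb{R}$ be a loss function such that $w\mapsto\ell(w;z)$ is $G$-Lipschitz (in the Euclidean norm) for every $z\in Z$, and, for a dataset $S=(z_1,\dots,z_n)\in Z^n$, put $f_i(w)=\ell(w;z_i)$. Let $T\ge 1$ and $1\le b\le n$ be integers, $\sigma\ge 0$, $w^0\in\mathbb{R}^d$, and let $\eta_0,\eta_1,\dots\in\mathbb{R}$ be step sizes (for instance all equal to one $\eta$). Let $A_\sigma=I-\sigma L\in\mathbb{R}^{d\times d}$, where $L$ is the one-dimensional discrete Laplacian with periodic boundary condition, $(Lu)_i=u_{i+1}-2u_i+u_{i-1}$ with indices modulo $d$. On the dataset $S$, DP-LSSGD computes, for $k=0,\dots,T-1$, $$w^{k+1}=w^k-\eta_k A_\sigma^{-1}\Big(\frac1b\sum_{i\in\mathcal{B}_k}\nabla f_i(w^k)+\mathbf{n}_k\Big),$$ where $\mathcal{B}_k$ is uniformly distributed over the $b$-element subsets of $\{1,\dots,n\}$, $\mathbf{n}_k\sim\mathcal{N}(0,\nu^2 I)$, and all the $\mathcal{B}_k$ and $\mathbf{n}_k$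 are independent; it outputs $w^T$. (At a point where $f_i$ is not differentiable, $\nabla f_i$ is taken to be $0$.) Let $\epsilon,\delta>0$ and $\mu\in(0,1)$, and put $$\alpha=\frac{\log(1/\delta)}{(1-\mu)\epsilon}+1,\qquad \nu^2=\frac{20\,T\alpha G^2}{\mu n^2\epsilon}.$$ If $$\alpha\le\log\Big(\frac{\mu n^3\epsilon}{5b^3T\alpha+\mu b n^2\epsilon}\Big)\qquad\text{and}\qquad \frac{5b^2T\alpha}{\mu n^2\epsilon}\ge 1.5,$$ then DP-LSSGD with this noise variance $\nu^2$ is $(\epsilon,\delta)$-differentially private: for any two datasets $S,S'\in Z^n$ that differ in exactly one entry and every measurable $O\subseteq\mathbb{R}^d$, $$\mathbb{P}[w^T(S)\in O]\le e^{\epsilon}\,\mathbb{P}[w^T(S')\in O]+\delta .$$ -/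

import Mathlib

open MeasureTheory ProbabilityTheory
open scoped NNReal ENNReal

noncomputable section

namespace DPLSSGD

/-- Two datasets with `n` entries are adjacent if they differ in exactly one entry. -/
def Adjacent {Z : Type*} {n : ℕ} (S S' : Fin n → Z) : Prop :=
  ∃! i, S i ≠ S' i

/-- A randomized mechanism on datasets with `n` entries, given by the law `M S` of its output on
each dataset `S`, is `(ε, δ)`-differentially private. -/
def IsDifferentiallyPrivate {Z R : Type*} [MeasurableSpace R] {n : ℕ}
    (M : (Fin n → Z) → Measure R) (ε δ : ℝ) : Prop :=
  ∀ S S' : Fin n → Z, Adjacent S S' → ∀ O : Set R, MeasurableSet O →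
    M S O ≤ ENNReal.ofReal (Real.exp ε) * M S' O + ENNReal.ofReal δ

/-- The discrete one-dimensional Laplacian with periodic boundary condition,
`(L u) i = u (i + 1) - 2 * u i + u (i - 1)`, the indices being read modulo `d`. -/
def laplacian (d : ℕ) : Matrix (Fin d) (Fin d) ℝ :=
  Matrix.of fun i j =>
    (if j = finRotate d i then 1 else 0) + (if i = finRotate d j then 1 else 0)
      - 2 * (if i = j then 1 else 0)

/-- The Laplacian smoothing matrix `A_σ = I - σ L`. -/
def smoothingMatrix (d : ℕ) (σ : ℝ) : Matrix (Fin d) (Fin d) ℝ :=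
  1 - σ • laplacian d

/-- The law on `ℝ^d` of a vector with independent `N(0, v)` coordinates (`v` is the variance). -/
def gaussianNoise (d : ℕ) (v : ℝ≥0) : Measure (EuclideanSpace ℝ (Fin d)) :=
  (Measure.pi fun _ : Fin d => gaussianReal 0 v).map (MeasurableEquiv.toLp 2 (Fin d → ℝ))

/-- The minibatch gradient `(1 / b) * ∑ i ∈ B, ∇ f_i (w)`, where `f_i = ℓ(·; S i)`. -/
def batchGradient {Z : Type*} {d n : ℕ} (loss : EuclideanSpace ℝ (Fin d) → Z → ℝ) (b : ℕ)
    (S : Fin n → Z) (B : Finset (Fin n)) (w : EuclideanSpace ℝ (Fin d)) :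
    EuclideanSpace ℝ (Fin d) :=
  (1 / (b : ℝ)) • ∑ i ∈ B, gradient (fun v => loss v (S i)) w

/-- One update `w - η A_σ⁻¹ ((1 / b) * ∑ i ∈ B, ∇ f_i (w) + ξ)`, given the minibatch `B` and the
noise vector `ξ`. -/
def update {Z : Type*} {d n : ℕ} (loss : EuclideanSpace ℝ (Fin d) → Z → ℝ) (σ : ℝ) (b : ℕ)
    (η : ℝ) (S : Fin n → Z) (B : Finset (Fin n)) (w ξ : EuclideanSpace ℝ (Fin d)) :
    EuclideanSpace ℝ (Fin d) :=
  w - η • Matrix.toEuclideanLin (smoothingMatrix d σ)⁻¹ (batchGradient loss b S B w + ξ)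

/-- The law of the `k`-th iterate of DP-LSSGD on the dataset `S`, started at `w₀`, with step sizes
`η`, minibatch size `b` and noise variance `v` per coordinate. At each iteration the minibatch is
uniformly distributed over the `b`-element subsets of the index set (sampling without replacement)
and the noise is Gaussian; both are drawn afresh, independently of each other and of the past. -/
def iterateLaw {Z : Type*} {d n : ℕ} (loss : EuclideanSpace ℝ (Fin d) → Z → ℝ) (σ : ℝ) (b : ℕ)
    (η : ℕ → ℝ) (v : ℝ≥0) (w₀ : EuclideanSpace ℝ (Fin d)) (S : Fin n → Z) :
    ℕ → Measure (EuclideanSpace ℝ (Fin d))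
  | 0 => Measure.dirac w₀
  | k + 1 => ((n.choose b : ℝ≥0∞))⁻¹ • ∑ B ∈ Finset.powersetCard b (Finset.univ : Finset (Fin n)),
      ((iterateLaw loss σ b η v w₀ S k).prod (gaussianNoise d v)).map
        fun p => update loss σ b (η k) S B p.1 p.2

/-- DP-LSSGD run for `T` iterations, as a randomized mechanism: its output is the iterate `w^T`. -/
def mechanism {Z : Type*} {d n : ℕ} (loss : EuclideanSpace ℝ (Fin d) → Z → ℝ) (σ : ℝ) (b T : ℕ)
    (η : ℕ → ℝ) (v : ℝ≥0) (w₀ : EuclideanSpace ℝ (Fin d)) (S : Fin n → Z) :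
    Measure (EuclideanSpace ℝ (Fin d)) :=
  iterateLaw loss σ b η v w₀ S T

/-- The order `α = log (1 / δ) / ((1 - μ) ε) + 1`. -/
def order (ε δ μ : ℝ) : ℝ :=
  Real.log (1 / δ) / ((1 - μ) * ε) + 1

/-- The noise variance `ν² = 20 T α G² / (μ n² ε)`. -/
def noiseVariance (n T : ℕ) (G ε δ μ : ℝ) : ℝ :=
  20 * T * order ε δ μ * G ^ 2 / (μ * n ^ 2 * ε)

instance (d : ℕ) (v : ℝ≥0) : IsProbabilityMeasure (gaussianNoise d v) :=
  Measure.isProbabilityMeasure_map (MeasurableEquiv.measurable _).aemeasurable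

/-- The update is measurable in the current iterate and the noise. -/
theorem measurable_update {Z : Type*} {d n : ℕ} (loss : EuclideanSpace ℝ (Fin d) → Z → ℝ)
    (σ : ℝ) (b : ℕ) (η : ℝ) (S : Fin n → Z) (B : Finset (Fin n)) :
    Measurable fun p : EuclideanSpace ℝ (Fin d) × EuclideanSpace ℝ (Fin d) =>
      update loss σ b η S B p.1 p.2 := by
  have hg : ∀ i, Measurable (gradient fun v => loss v (S i)) := fun i =>
    (InnerProductSpace.toDual ℝ (EuclideanSpace ℝ (Fin d))).symm.continuous.measurable.comp
      (measurable_fderiv ℝ _)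
  have hb : Measurable (batchGradient loss b S B) := by
    have hs : Measurable fun w => ∑ i ∈ B, gradient (fun v => loss v (S i)) w :=
      Finset.measurable_fun_sum B fun i _ => hg i
    exact hs.const_smul (1 / (b : ℝ))
  have hA : Measurable (Matrix.toEuclideanLin (smoothingMatrix d σ)⁻¹) :=
    (LinearMap.continuous_of_finiteDimensional _).measurable
  unfold update
  exact measurable_fst.sub
    ((hA.comp ((hb.comp measurable_fst).add measurable_snd)).const_smul η)

/-- The laws of the iterates are probability measures. -/
theorem isProbabilityMeasure_iterateLaw {Z : Type*} {d n : ℕ}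
    (loss : EuclideanSpace ℝ (Fin d) → Z → ℝ) (σ : ℝ) (b : ℕ) (hb : b ≤ n)
    (η : ℕ → ℝ) (v : ℝ≥0) (w₀ : EuclideanSpace ℝ (Fin d)) (S : Fin n → Z) (k : ℕ) :
    IsProbabilityMeasure (iterateLaw loss σ b η v w₀ S k) := by
  induction k with
  | zero => unfold iterateLaw; infer_instance
  | succ k ih =>
    have h : ∀ B : Finset (Fin n), (((iterateLaw loss σ b η v w₀ S k).prod
        (gaussianNoise d v)).map fun p => update loss σ b (η k) S B p.1 p.2) Set.univ = 1 :=
      fun B => (Measure.isProbabilityMeasure_map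
        (measurable_update loss σ b (η k) S B).aemeasurable).measure_univ
    refine ⟨?_⟩
    have h0 : (n.choose b : ℝ≥0∞) ≠ 0 := by
      exact_mod_cast (Nat.choose_pos hb).ne'
    simp [iterateLaw, h, ENNReal.inv_mul_cancel h0 (ENNReal.natCast_ne_top _)]

end DPLSSGD

end

/-!
DP-LSSGD touches the data only through the noisy minibatch gradients: the matrix `A_σ⁻¹` and the
step sizes act on them by a map that does not depend on the data. So the algorithm is
post-processing of an adaptive composition of `T` Gaussian mechanisms, each subsampled at the rate
`τ = b / n`, and it is analysed with Rényi divergences of order `α`. These are used in a dual form,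
`MomentDominated`: an inequality between integrals of test functions, with the exponent conjugate
to `α`. In this form post-processing (`MomentDominated.map`), adaptive composition
(`MomentDominated.bind`) and joint convexity (`MomentDominated.sum`) need no densities, and
weighted AM-GM converts the bound to `(ε, δ)`-privacy (`MomentDominated.measure_le`).

For a single step, fix the index `i₀` at which the datasets differ. A uniform minibatch arises from
a uniform minibatch `B` avoiding `i₀` by exchanging, with probability `τ`, a random element of `B`
for `i₀` (`average_powersetCard_eq`). By joint convexity it suffices to compare
`(1 - τ) N(a) + τ N(p)` with `(1 - τ) N(a) + τ N(q)`, where `a`, `p`, `q` are gradients at mutual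
distance at most `2 G / b`; let `r` be the square of `2 G / b` divided by the variance. With
respect to `N(a)` these mixtures have the densities `P = 1 - τ + τ ρ_u` and `Q = 1 - τ + τ ρ_w`,
where `ρ_u` and `ρ_w` are given by the Cameron–Martin formula (`map_add_gaussianNoise`). For an
integer `N`, expand `(P / Q) ^ N` in powers of `P / Q - 1 = τ (ρ_u - ρ_w) / Q`: the first order
term integrates to zero, the second is at most a constant times `N (N - 1) τ² r`, and the higher
ones are of that size too, since `τ (1 + 1 / r) ≤ exp (-α)` outweighs the growth of the Gaussian
moments (`integral_ratio_pow_le`). Interpolation between consecutive integers gives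
`∫ (P / Q) ^ α Q ≤ exp (5 α (α - 1) τ² r)` for real `α` (`lintegral_ratio_rpow_le`). With the given
noise variance this equals `exp ((α - 1) μ ε / T)`; composition over `T` steps gives the Rényi
divergence bound `μ ε`, and the conversion adds `log (1 / δ) / (α - 1) = (1 - μ) ε`.
-/

namespace DPLSSGD

/-! ### Likelihood ratio bounds in dual form -/

section MomentDominated

variable {X Y : Type*} [MeasurableSpace X] [MeasurableSpace Y]

/-- A bound on the likelihood ratio of `μ` with respect to `ν` in dual form: integration against `μ`
is bounded, with constant `c`, by the `L^q(ν)` seminorm. If `α` is the exponent conjugate to `q`,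
then this says that `dμ/dν` has `L^α(ν)`-norm at most `c`, that is, that the Rényi divergence of
order `α` satisfies `exp ((α - 1) D_α(μ ‖ ν)) ≤ c ^ α`. The dual form needs no densities. -/
def MomentDominated (q : ℝ) (c : ℝ≥0∞) (μ ν : Measure X) : Prop :=
  ∀ f : X → ℝ≥0∞, Measurable f → ∫⁻ x, f x ∂μ ≤ c * (∫⁻ x, f x ^ q ∂ν) ^ (1 / q)

variable {q : ℝ} {c c' : ℝ≥0∞} {μ ν : Measure X}

theorem MomentDominated.map (h : MomentDominated q c μ ν) {g : X → Y} (hg : Measurable g) :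
    MomentDominated q c (μ.map g) (ν.map g) := by
  intro f hf
  rw [lintegral_map hf hg, lintegral_map (hf.pow_const q) hg]
  exact h _ (hf.comp hg)

/-- Adaptive composition: the constants multiply. -/
theorem MomentDominated.bind (hq : 0 < q) (h : MomentDominated q c μ ν) {κ κ' : X → Measure Y}
    (hκ : Measurable κ) (hκ' : Measurable κ') (hc : ∀ x, MomentDominated q c' (κ x) (κ' x)) :
    MomentDominated q (c * c') (μ.bind κ) (ν.bind κ') := by
  intro f hf
  have hfq : Measurable fun y => f y ^ q := hf.pow_const q
  have hm : Measurable fun x => ∫⁻ y, f y ^ q ∂κ' x := (Measure.measurable_lintegral hfq).comp hκ'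
  rw [Measure.lintegral_bind hκ.aemeasurable hf.aemeasurable,
    Measure.lintegral_bind hκ'.aemeasurable hfq.aemeasurable]
  calc ∫⁻ x, ∫⁻ y, f y ∂κ x ∂μ
      ≤ ∫⁻ x, c' * (∫⁻ y, f y ^ q ∂κ' x) ^ (1 / q) ∂μ := lintegral_mono fun x => hc x f hf
    _ = c' * ∫⁻ x, (∫⁻ y, f y ^ q ∂κ' x) ^ (1 / q) ∂μ := lintegral_const_mul _ (hm.pow_const _)
    _ ≤ c' * (c * (∫⁻ x, ((∫⁻ y, f y ^ q ∂κ' x) ^ (1 / q)) ^ q ∂ν) ^ (1 / q)) := by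
        gcongr
        exact h _ (hm.pow_const _)
    _ = c * c' * (∫⁻ x, ∫⁻ y, f y ^ q ∂κ' x ∂ν) ^ (1 / q) := by
        simp_rw [← ENNReal.rpow_mul, one_div_mul_cancel hq.ne', ENNReal.rpow_one]
        ring

/-- Joint convexity: a common mixture preserves the bound. -/
theorem MomentDominated.sum (hq : 1 ≤ q) {ι : Type*} (s : Finset ι) (w : ι → ℝ≥0∞)
    (hw : ∑ i ∈ s, w i = 1) {μ ν : ι → Measure X} (h : ∀ i ∈ s, MomentDominated q c (μ i) (ν i)) :
    MomentDominated q c (∑ i ∈ s, w i • μ i) (∑ i ∈ s, w i • ν i) := by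
  intro f hf
  have hq0 : 0 < q := one_pos.trans_le hq
  simp only [lintegral_finsetSum_measure, lintegral_smul_measure, smul_eq_mul]
  calc ∑ i ∈ s, w i * ∫⁻ x, f x ∂μ i
      ≤ ∑ i ∈ s, w i * (c * (∫⁻ x, f x ^ q ∂ν i) ^ (1 / q)) := by
        gcongr with i hi
        exact h i hi f hf
    _ = c * ∑ i ∈ s, w i * (∫⁻ x, f x ^ q ∂ν i) ^ (1 / q) := by
        rw [Finset.mul_sum]
        exact Finset.sum_congr rfl fun i _ => by ring
    _ ≤ c * (∑ i ∈ s, w i * ∫⁻ x, f x ^ q ∂ν i) ^ (1 / q) := by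
        gcongr
        rw [one_div, ENNReal.le_rpow_inv_iff hq0]
        refine (ENNReal.rpow_arith_mean_le_arith_mean_rpow s w _ hw hq).trans_eq ?_
        simp_rw [← ENNReal.rpow_mul, inv_mul_cancel₀ hq0.ne', ENNReal.rpow_one]

theorem momentDominated_dirac (hq : 0 < q) (x : X) :
    MomentDominated q 1 (Measure.dirac x) (Measure.dirac x) := by
  intro f hf
  rw [lintegral_dirac' _ hf, lintegral_dirac' _ (hf.pow_const q), ← ENNReal.rpow_mul,
    mul_one_div_cancel hq.ne', ENNReal.rpow_one, one_mul]

/-- The dual form of Hölder's inequality: a moment bound for the quotient `g / h` of densities gives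
domination of the corresponding measures. -/
theorem momentDominated_withDensity {α : ℝ} (hα : α.HolderConjugate q) (m : Measure X)
    {g h : X → ℝ} (hg : Measurable g) (hh : Measurable h) (hg0 : ∀ x, 0 ≤ g x)
    (hh0 : ∀ x, 0 < h x) {C : ℝ≥0∞}
    (hC : ∫⁻ x, ENNReal.ofReal ((g x / h x) ^ α * h x) ∂m ≤ C) :
    MomentDominated q (C ^ (1 / α)) (m.withDensity fun x => ENNReal.ofReal (g x))
      (m.withDensity fun x => ENNReal.ofReal (h x)) := by
  intro f hf
  have hα0 := hα.pos
  have hq0 := hα.symm.pos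
  rw [lintegral_withDensity_eq_lintegral_mul _ hg.ennreal_ofReal hf,
    lintegral_withDensity_eq_lintegral_mul _ hh.ennreal_ofReal (hf.pow_const q)]
  have key : ∀ x, ENNReal.ofReal (g x) * f x =
      ENNReal.ofReal (g x / h x * h x ^ (1 / α)) * (f x * ENNReal.ofReal (h x ^ (1 / q))) := by
    intro x
    have h1 : h x ^ (1 / α) * h x ^ (1 / q) = h x := by
      rw [← Real.rpow_add (hh0 x)]
      simp [hα.inv_add_inv_eq_one]
    rw [mul_left_comm, ← ENNReal.ofReal_mul (by have := hg0 x; have := hh0 x; positivity),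
      mul_assoc, h1, div_mul_cancel₀ _ (hh0 x).ne', mul_comm]
  have m1 : Measurable fun x => ENNReal.ofReal (g x / h x * h x ^ (1 / α)) :=
    ((hg.div hh).mul (hh.pow_const _)).ennreal_ofReal
  have m2 : Measurable fun x => f x * ENNReal.ofReal (h x ^ (1 / q)) :=
    hf.mul (hh.pow_const _).ennreal_ofReal
  simp only [Pi.mul_apply, key]
  refine (ENNReal.lintegral_mul_le_Lp_mul_Lq m hα m1.aemeasurable m2.aemeasurable).trans
    (mul_le_mul' (ENNReal.rpow_le_rpow (le_trans (le_of_eq (lintegral_congr fun x => ?_)) hC)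
      (by positivity)) (le_of_eq (congrArg (· ^ (1 / q)) (lintegral_congr fun x => ?_))))
  · have := hg0 x
    have := hh0 x
    rw [ENNReal.ofReal_rpow_of_nonneg (by positivity) hα0.le, Real.mul_rpow (by positivity)
      (by positivity), ← Real.rpow_mul (hh0 x).le, one_div_mul_cancel hα0.ne', Real.rpow_one]
  · have := hh0 x
    rw [ENNReal.mul_rpow_of_nonneg _ _ hq0.le, ENNReal.ofReal_rpow_of_nonneg (by positivity) hq0.le,
      ← Real.rpow_mul (hh0 x).le, one_div_mul_cancel hq0.ne', Real.rpow_one, mul_comm]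

/-- Conversion of a Rényi bound of order `α` into approximate differential privacy, by the weighted
inequality of arithmetic and geometric means. -/
theorem MomentDominated.measure_le {α κ δ : ℝ} (hα : α.HolderConjugate q) (hδ : 0 < δ)
    [IsFiniteMeasure ν]
    (h : MomentDominated q (ENNReal.ofReal (Real.exp ((α - 1) * κ)) ^ (1 / α)) μ ν)
    {O : Set X} (hO : MeasurableSet O) :
    μ O ≤ ENNReal.ofReal (Real.exp (κ + Real.log (1 / δ) / (α - 1))) * ν O + ENNReal.ofReal δ := by
  have hα0 := hα.pos
  have hq0 := hα.symm.pos
  have hα1 : 0 < α - 1 := hα.sub_one_pos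
  have h1 := h (O.indicator 1) (measurable_one.indicator hO)
  have h2 : ∀ x, (O.indicator (1 : X → ℝ≥0∞) x) ^ q = O.indicator 1 x := by
    intro x
    by_cases hx : x ∈ O <;> simp [hx, hq0]
  simp only [h2, lintegral_indicator_one hO] at h1
  refine h1.trans ?_
  obtain ⟨x, hx0, hx⟩ : ∃ x : ℝ, 0 ≤ x ∧ ν O = ENNReal.ofReal x :=
    ⟨(ν O).toReal, ENNReal.toReal_nonneg, (ENNReal.ofReal_toReal (measure_ne_top ν O)).symm⟩
  have hqα : 1 / q = (α - 1) / α := by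
    have := hα.inv_add_inv_eq_one
    field_simp at this ⊢
    linarith
  rw [hx, ENNReal.ofReal_rpow_of_nonneg (Real.exp_pos _).le (by positivity),
    ENNReal.ofReal_rpow_of_nonneg hx0 (by positivity), ← ENNReal.ofReal_mul (by positivity),
    ← ENNReal.ofReal_mul (by positivity), ← ENNReal.ofReal_add (by positivity) hδ.le]
  apply ENNReal.ofReal_le_ofReal
  set y := Real.exp (κ + Real.log (1 / δ) / (α - 1)) * x with hy
  have hy0 : 0 ≤ y := by positivity
  have amgm := Real.geom_mean_le_arith_mean2_weighted (w₁ := (α - 1) / α) (w₂ := 1 / α)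
    (by positivity) (by positivity) hy0 hδ.le (by field_simp; ring)
  have hl : Real.exp ((α - 1) * κ) ^ (1 / α) * x ^ (1 / q) =
      y ^ ((α - 1) / α) * δ ^ (1 / α) := by
    rw [hy, Real.mul_rpow (Real.exp_pos _).le hx0, hqα, ← Real.exp_mul, ← Real.exp_mul,
      Real.rpow_def_of_pos hδ, mul_right_comm (Real.exp _) (x ^ _), ← Real.exp_add, one_div δ,
      Real.log_inv]
    congr 2
    field_simp
    ring
  rw [hl]
  refine amgm.trans ?_
  have e1 : (α - 1) / α ≤ 1 := by rw [div_le_one hα0]; linarith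
  have e2 : 1 / α ≤ 1 := by rw [div_le_one hα0]; linarith
  exact add_le_add (mul_le_of_le_one_left hy0 e1) (mul_le_of_le_one_left hδ.le e2)

end MomentDominated

/-! ### Translates of the Gaussian noise -/

section Gaussian

theorem pi_withDensity {ι : Type*} [Fintype ι] {X : ι → Type*} [∀ i, MeasurableSpace (X i)]
    (μ : ∀ i, Measure (X i)) [∀ i, IsProbabilityMeasure (μ i)] {f : ∀ i, X i → ℝ≥0∞}
    (hf : ∀ i, Measurable (f i)) [∀ i, IsProbabilityMeasure ((μ i).withDensity (f i))] :
    Measure.pi (fun i => (μ i).withDensity (f i)) =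
      (Measure.pi μ).withDensity fun x => ∏ i, f i (x i) := by
  refine Measure.pi_eq fun s hs => ?_
  have hm : ∀ i, Measurable ((s i).indicator (f i)) := fun i => (hf i).indicator (hs i)
  have hind : iIndepFun (fun i (x : ∀ i, X i) => (s i).indicator (f i) (x i)) (Measure.pi μ) :=
    iIndepFun_pi fun i => (hm i).aemeasurable
  rw [withDensity_apply _ (MeasurableSet.univ_pi hs),
    ← lintegral_indicator (MeasurableSet.univ_pi hs)]
  have e1 : ∀ x : ∀ i, X i, (Set.univ.pi s).indicator (fun x => ∏ i, f i (x i)) x =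
      ∏ i, (s i).indicator (f i) (x i) := by
    intro x
    by_cases hx : x ∈ Set.univ.pi s
    · rw [Set.indicator_of_mem hx]
      exact Finset.prod_congr rfl fun i _ => (Set.indicator_of_mem (hx i trivial) _).symm
    · rw [Set.indicator_of_notMem hx]
      simp only [Set.mem_univ_pi, not_forall] at hx
      obtain ⟨i, hi⟩ := hx
      exact (Finset.prod_eq_zero (Finset.mem_univ i) (Set.indicator_of_notMem hi _)).symm
  rw [lintegral_congr e1, lintegral_prod_eq_prod_lintegral_of_indepFun Finset.univ _ hind
    fun i => (hm i).comp (measurable_pi_apply i)]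
  refine Finset.prod_congr rfl fun i _ => ?_
  rw [withDensity_apply _ (hs i), ← lintegral_indicator (hs i)]
  exact (measurePreserving_eval μ i).lintegral_comp (hm i)

theorem gaussianReal_eq_withDensity (u : ℝ) {v : ℝ≥0} (hv : v ≠ 0) :
    gaussianReal u v = (gaussianReal 0 v).withDensity fun x =>
      ENNReal.ofReal (Real.exp ((u * x - u ^ 2 / 2) / v)) := by
  have hv' : (v : ℝ) ≠ 0 := by exact_mod_cast hv
  rw [gaussianReal_of_var_ne_zero _ hv, gaussianReal_of_var_ne_zero _ hv,
    ← withDensity_mul _ (measurable_gaussianPDF 0 v) (by fun_prop)]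
  congr 1
  ext x
  rw [Pi.mul_apply, gaussianPDF, gaussianPDF, ← ENNReal.ofReal_mul (gaussianPDFReal_nonneg _ _ _),
    gaussianPDFReal, gaussianPDFReal, mul_assoc (√(2 * Real.pi * v))⁻¹, ← Real.exp_add]
  congr 3
  field_simp
  ring

variable {d : ℕ}

/-- The density of `N(u, v I)` with respect to `N(0, v I)`. -/
noncomputable def gaussianShift (v : ℝ≥0) (u x : EuclideanSpace ℝ (Fin d)) : ℝ :=
  Real.exp ((inner ℝ u x - ‖u‖ ^ 2 / 2) / v)

theorem gaussianShift_pos (v : ℝ≥0) (u x : EuclideanSpace ℝ (Fin d)) :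
    0 < gaussianShift v u x :=
  Real.exp_pos _

@[fun_prop]
theorem measurable_gaussianShift (v : ℝ≥0) (u : EuclideanSpace ℝ (Fin d)) :
    Measurable (gaussianShift v u) := by
  unfold gaussianShift
  fun_prop

/-- The Cameron–Martin formula. -/
theorem map_add_gaussianNoise {v : ℝ≥0} (hv : v ≠ 0) (u : EuclideanSpace ℝ (Fin d)) :
    (gaussianNoise d v).map (fun x => u + x) =
      (gaussianNoise d v).withDensity fun x => ENNReal.ofReal (gaussianShift v u x) := by
  have h1 : (Measure.pi fun _ : Fin d => gaussianReal 0 v).map (fun x i => u i + x i) =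
      (Measure.pi fun _ : Fin d => gaussianReal 0 v).withDensity fun x =>
        ∏ i, ENNReal.ofReal (Real.exp ((u i * x i - u i ^ 2 / 2) / v)) := by
    have hi : ∀ i, gaussianReal (u i) v = (gaussianReal 0 v).withDensity fun x =>
      ENNReal.ofReal (Real.exp ((u i * x - u i ^ 2 / 2) / v)) :=
        fun i => gaussianReal_eq_withDensity (u i) hv
    have hp : ∀ i, IsProbabilityMeasure ((gaussianReal 0 v).withDensity fun x =>
        ENNReal.ofReal (Real.exp ((u i * x - u i ^ 2 / 2) / v))) := fun i => by
      rw [← hi]; infer_instance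
    rw [← pi_withDensity (fun _ : Fin d => gaussianReal 0 v)
        (f := fun i x => ENNReal.ofReal (Real.exp ((u i * x - u i ^ 2 / 2) / v)))
        (fun i => by fun_prop),
      Measure.pi_map_pi (fun i => by fun_prop)]
    congr 1
    ext1 i
    rw [gaussianReal_map_const_add, zero_add, hi i]
  have hm : Measurable fun x : EuclideanSpace ℝ (Fin d) => u + x := by fun_prop
  ext s hs
  rw [gaussianNoise, Measure.map_map hm (MeasurableEquiv.measurable _),
    withDensity_apply _ hs, setLIntegral_map hs (by fun_prop) (MeasurableEquiv.measurable _)]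
  have e : (fun x : EuclideanSpace ℝ (Fin d) => u + x) ∘ (MeasurableEquiv.toLp 2 (Fin d → ℝ)) =
      (MeasurableEquiv.toLp 2 (Fin d → ℝ)) ∘ (fun x i => u i + x i) := by
    ext x i
    simp
  rw [e, ← Measure.map_map (MeasurableEquiv.measurable _) (by fun_prop), h1,
    Measure.map_apply (MeasurableEquiv.measurable _) hs,
    withDensity_apply _ (MeasurableEquiv.measurable _ hs)]
  refine lintegral_congr fun x => ?_
  rw [← ENNReal.ofReal_prod_of_nonneg fun _ _ => (Real.exp_pos _).le, ← Real.exp_sum,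
    gaussianShift, EuclideanSpace.norm_sq_eq, PiLp.inner_apply, ← Finset.sum_div,
    Finset.sum_sub_distrib, Finset.sum_div]
  simp [mul_comm]

theorem integrable_gaussianShift {v : ℝ≥0} (hv : v ≠ 0) (u : EuclideanSpace ℝ (Fin d)) :
    Integrable (gaussianShift v u) (gaussianNoise d v) ∧
      ∫ x, gaussianShift v u x ∂gaussianNoise d v = 1 := by
  have h : ∫⁻ x, ENNReal.ofReal (gaussianShift v u x) ∂gaussianNoise d v = 1 := by
    have := congrArg (· Set.univ) (map_add_gaussianNoise hv u)
    have hm : Measurable fun x : EuclideanSpace ℝ (Fin d) => u + x := by fun_prop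
    simpa [Measure.map_apply hm MeasurableSet.univ] using this.symm
  have hint : Integrable (gaussianShift v u) (gaussianNoise d v) := by
    refine (lintegral_ofReal_ne_top_iff_integrable (by fun_prop) ?_).1 (by simp [h])
    exact Filter.Eventually.of_forall fun x => (gaussianShift_pos v u x).le
  refine ⟨hint, ?_⟩
  rw [integral_eq_lintegral_of_nonneg_ae
    (Filter.Eventually.of_forall fun x => (gaussianShift_pos v u x).le) (by fun_prop), h]
  simp

theorem gaussianShift_mul (v : ℝ≥0) (u w x : EuclideanSpace ℝ (Fin d)) :
    gaussianShift v u x * gaussianShift v w x =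
      Real.exp (inner ℝ u w / v) * gaussianShift v (u + w) x := by
  simp only [gaussianShift, ← Real.exp_add, inner_add_left, norm_add_sq_real]
  congr 1
  ring

theorem gaussianShift_pow (v : ℝ≥0) (u x : EuclideanSpace ℝ (Fin d)) (j : ℕ) :
    gaussianShift v u x ^ j =
      Real.exp (j * (j - 1) / 2 * (‖u‖ ^ 2 / v)) * gaussianShift v ((j : ℝ) • u) x := by
  simp only [gaussianShift, ← Real.exp_add, ← Real.exp_nat_mul, inner_smul_left, norm_smul]
  congr 1
  simp only [RCLike.conj_to_real, Real.norm_natCast]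
  ring

theorem integrable_gaussianShift_mul {v : ℝ≥0} (hv : v ≠ 0) (u w : EuclideanSpace ℝ (Fin d)) :
    Integrable (fun x => gaussianShift v u x * gaussianShift v w x) (gaussianNoise d v) ∧
      ∫ x, gaussianShift v u x * gaussianShift v w x ∂gaussianNoise d v =
        Real.exp (inner ℝ u w / v) := by
  simp only [gaussianShift_mul]
  obtain ⟨h1, h2⟩ := integrable_gaussianShift hv (u + w)
  exact ⟨h1.const_mul _, by rw [integral_const_mul, h2, mul_one]⟩

theorem integrable_gaussianShift_pow {v : ℝ≥0} (hv : v ≠ 0) (u : EuclideanSpace ℝ (Fin d)) (j : ℕ) :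
    Integrable (fun x => gaussianShift v u x ^ j) (gaussianNoise d v) ∧
      ∫ x, gaussianShift v u x ^ j ∂gaussianNoise d v =
        Real.exp (j * (j - 1) / 2 * (‖u‖ ^ 2 / v)) := by
  simp only [gaussianShift_pow]
  obtain ⟨h1, h2⟩ := integrable_gaussianShift hv ((j : ℝ) • u)
  exact ⟨h1.const_mul _, by rw [integral_const_mul, h2, mul_one]⟩

end Gaussian

/-! ### Moments of the likelihood ratio of two Gaussian mixtures -/

section MomentBounds

/-- Binomial expansion of `(P / Q) ^ N * Q` with `N = K + 2`, `P = 1 - τ + τ a`, `Q = 1 - τ + τ b`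
around `P / Q = 1`. The first three terms are kept with their cancellations; in the others the
differences `a - b` are estimated by `a` and `b`. -/
theorem ratio_pow_mul_le {a b τ : ℝ} (ha : 0 ≤ a) (hb : 0 ≤ b) (hτ : 0 < τ) (hτ1 : τ < 1) (K : ℕ) :
    ((1 - τ + τ * a) / (1 - τ + τ * b)) ^ (K + 2) * (1 - τ + τ * b) ≤
      (1 - τ + τ * b) + (K + 2) * τ * (a - b)
        + (K + 2) * (K + 1) / 2 * (τ ^ 2 / (1 - τ)) * (a - b) ^ 2
        + ∑ i ∈ Finset.range K, ((K + 2).choose (i + 3) : ℝ) * (τ * (τ / (1 - τ)) ^ (i + 2))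
          * (a ^ (i + 3) + b ^ (i + 3)) := by
  have h1τ : 0 < 1 - τ := by linarith
  set Q := 1 - τ + τ * b with hQ
  have hQ0 : 1 - τ ≤ Q := by rw [hQ]; nlinarith
  have hQpos : 0 < Q := h1τ.trans_le hQ0
  set x := τ * (a - b) / Q with hx
  have hxQ : x * Q = τ * (a - b) := by rw [hx]; field_simp
  have hP : (1 - τ + τ * a) / Q = x + 1 := by
    rw [div_eq_iff hQpos.ne', add_mul, hxQ, hQ]; ring
  have habs : |x| * Q = τ * |a - b| := by
    rw [← abs_of_pos hτ, ← abs_mul, ← hxQ, abs_mul, abs_of_pos hQpos]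
  have hxle : |x| ≤ τ / (1 - τ) * |a - b| := by
    rw [div_mul_eq_mul_div, le_div_iff₀ h1τ, ← habs]
    exact mul_le_mul_of_nonneg_left hQ0 (abs_nonneg x)
  have hhigh : ∀ i : ℕ, x ^ (i + 3) * Q ≤
      τ * (τ / (1 - τ)) ^ (i + 2) * (a ^ (i + 3) + b ^ (i + 3)) := by
    intro i
    have hd : |a - b| ^ (i + 3) ≤ a ^ (i + 3) + b ^ (i + 3) := by
      rcases le_total a b with h | h
      · rw [abs_of_nonpos (by linarith)]
        have := pow_le_pow_left₀ (by linarith) (by linarith : -(a - b) ≤ b) (i + 3)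
        have := pow_nonneg ha (i + 3)
        linarith
      · rw [abs_of_nonneg (by linarith)]
        have := pow_le_pow_left₀ (by linarith) (by linarith : a - b ≤ a) (i + 3)
        have := pow_nonneg hb (i + 3)
        linarith
    calc x ^ (i + 3) * Q ≤ |x| ^ (i + 3) * Q := by
          rw [← abs_pow]
          exact mul_le_mul_of_nonneg_right (le_abs_self _) hQpos.le
      _ = |x| ^ (i + 2) * (|x| * Q) := by ring
      _ ≤ (τ / (1 - τ) * |a - b|) ^ (i + 2) * (|x| * Q) := by gcongr
      _ = τ * (τ / (1 - τ)) ^ (i + 2) * |a - b| ^ (i + 3) := by rw [habs]; ring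
      _ ≤ _ := by gcongr
  have h2 : x ^ 2 * Q ≤ τ ^ 2 / (1 - τ) * (a - b) ^ 2 := by
    have e : x ^ 2 * Q = τ ^ 2 / Q * (a - b) ^ 2 := by rw [hx]; field_simp
    rw [e]
    gcongr
  have hc2 : (((K + 2).choose 2 : ℕ) : ℝ) = (K + 2) * (K + 1) / 2 := by
    rw [Nat.cast_choose_two]; push_cast; ring
  rw [hP, add_pow, Finset.sum_range_succ', Finset.sum_range_succ', Finset.sum_range_succ']
  simp only [one_pow, mul_one, zero_add, pow_zero, pow_one, Nat.choose_zero_right,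
    Nat.choose_one_right, Nat.reduceAdd, hc2, add_mul, Finset.sum_mul, add_assoc,
    one_add_one_eq_two]
  have hsum : ∑ i ∈ Finset.range K, x ^ (i + 3) * ((K + 2).choose (i + 3) : ℝ) * Q ≤
      ∑ i ∈ Finset.range K, ((K + 2).choose (i + 3) : ℝ) * (τ * (τ / (1 - τ)) ^ (i + 2))
          * (a ^ (i + 3) + b ^ (i + 3)) := by
    refine Finset.sum_le_sum fun i _ => ?_
    have := mul_le_mul_of_nonneg_left (hhigh i) (Nat.cast_nonneg (α := ℝ) ((K + 2).choose (i + 3)))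
    linarith
  have hK : 0 ≤ ((K : ℝ) + 2) * (K + 1) / 2 := by positivity
  have h2' := mul_le_mul_of_nonneg_left h2 hK
  push_cast
  simp only [add_mul, mul_add] at *
  nlinarith

theorem sum_choose_mul_pow_le {θ : ℝ} (hθ : 0 ≤ θ) (K : ℕ) :
    ∑ i ∈ Finset.range K, ((K + 2).choose (i + 3) : ℝ) * θ ^ (i + 2) ≤
      (K + 2) * (K + 1) / 6 * (θ * ((1 + θ) ^ K - 1)) := by
  have hbin : (1 + θ) ^ K - 1 = ∑ i ∈ Finset.range K, (K.choose (i + 1) : ℝ) * θ ^ (i + 1) := by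
    rw [add_comm, add_pow, Finset.sum_range_succ']
    simp [mul_comm]
  rw [hbin, Finset.mul_sum, Finset.mul_sum]
  refine Finset.sum_le_sum fun i _ => ?_
  have hch : ((K + 2).choose (i + 3) : ℝ) * ((i + 3) * (i + 2)) =
      (K + 2) * (K + 1) * K.choose (i + 1) := by
    have h1 := Nat.add_one_mul_choose_eq (K + 1) (i + 2)
    have h2 := Nat.add_one_mul_choose_eq K (i + 1)
    have h1' : ((K : ℝ) + 1 + 1) * (K + 1).choose (i + 2) =
        (K + 2).choose (i + 3) * (i + 2 + 1) := by
      exact_mod_cast h1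
    have h2' : ((K : ℝ) + 1) * K.choose (i + 1) = (K + 1).choose (i + 2) * (i + 1 + 1) := by
      exact_mod_cast h2
    linear_combination (-(i + 2 : ℝ)) * h1' - (K + 2 : ℝ) * h2'
  have hle : ((K + 2).choose (i + 3) : ℝ) ≤ (K + 2) * (K + 1) / 6 * K.choose (i + 1) := by
    have h0 : (0 : ℝ) ≤ (K + 2).choose (i + 3) := Nat.cast_nonneg _
    have h6 : (6 : ℝ) ≤ (i + 3) * (i + 2) := by
      have : (0 : ℝ) ≤ i := Nat.cast_nonneg i
      nlinarith
    nlinarith [mul_le_mul_of_nonneg_left h6 h0]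
  calc ((K + 2).choose (i + 3) : ℝ) * θ ^ (i + 2)
      ≤ (K + 2) * (K + 1) / 6 * K.choose (i + 1) * θ ^ (i + 2) := by gcongr
    _ = _ := by ring

/-- The terms of order at least three are of the size of the second order term. One factor `r` comes
from the smallness of `τ`; the exponential `exp (-(K + 1))` beats the growth of the Gaussian
moments. Here `K + 2` is the order of the moment to be estimated. -/
theorem tail_le {r τ : ℝ} (hr : 0 < r) (hr1 : r ≤ 2 / 3) (hτ : 0 < τ) {K : ℕ} (hK : 1 ≤ K)
    (h : τ * (1 + 1 / r) ≤ Real.exp (-(K + 1))) :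
    (τ / (1 - τ) * Real.exp ((K + 2) / 3)) *
      ((1 + τ / (1 - τ) * Real.exp ((K + 2) / 3)) ^ K - 1) ≤ 3 * (τ * r) := by
  have hK1 : (1 : ℝ) ≤ K := by exact_mod_cast hK
  set e := Real.exp (-(K + 1 : ℝ)) with he
  have he0 : 0 < e := Real.exp_pos _
  have hτr : τ * (1 + r) ≤ e * r := by
    have := mul_le_mul_of_nonneg_right h hr.le
    field_simp at this
    linarith
  have hτ1 : τ ≤ e * r := by nlinarith
  have hτ2 : τ ≤ 2 / 5 * e := by nlinarith
  have hE : Real.exp (-(2 / 3)) ≤ 3 / 5 := by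
    rw [Real.exp_neg, inv_le_comm₀ (Real.exp_pos _) (by norm_num)]
    have := Real.add_one_le_exp (2 / 3 : ℝ)
    norm_num at this ⊢
    linarith
  have hE0 := Real.exp_pos (-(2 / 3))
  have he1 : e ≤ 27 / 125 := by
    have h1 : e ≤ Real.exp (-(2 / 3)) ^ 3 := by
      rw [← Real.exp_nat_mul]
      apply Real.exp_le_exp.2
      push_cast
      linarith
    have h2 : Real.exp (-(2 / 3)) ^ 3 ≤ (3 / 5) ^ 3 := by gcongr
    norm_num at h2
    linarith
  have hτ3 : τ ≤ 11 / 125 := by linarith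
  have h1τ : 0 < 1 - τ := by linarith
  set θ := τ / (1 - τ) * Real.exp ((K + 2) / 3) with hθ
  have hθ0 : 0 ≤ θ := by positivity
  have hinv : τ / (1 - τ) ≤ 125 / 114 * τ := by
    rw [div_le_iff₀ h1τ]
    nlinarith
  have hθ1 : θ ≤ 125 / 114 * τ * Real.exp ((K + 2) / 3) := by rw [hθ]; gcongr
  have hKθ : K * θ ≤ 1 / 4 := by
    have hk : (K : ℝ) ≤ 3 / 2 * Real.exp (2 / 3 * K - 1) := by
      have := Real.add_one_le_exp (2 / 3 * K - 1 : ℝ)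
      linarith
    have h3 : Real.exp (2 / 3 * K - 1) * (e * Real.exp ((K + 2) / 3)) =
        Real.exp (-(2 / 3)) ^ 2 := by
      rw [he, ← Real.exp_add, ← Real.exp_add, ← Real.exp_nat_mul]
      congr 1
      push_cast
      ring
    calc K * θ ≤ (3 / 2 * Real.exp (2 / 3 * K - 1)) *
          (125 / 114 * (2 / 5 * e) * Real.exp ((K + 2) / 3)) := by
          refine mul_le_mul hk (hθ1.trans ?_) hθ0 (by positivity)
          gcongr
      _ = 125 / 190 * (Real.exp (2 / 3 * K - 1) * (e * Real.exp ((K + 2) / 3))) := by ring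
      _ = 125 / 190 * Real.exp (-(2 / 3)) ^ 2 := by rw [h3]
      _ ≤ 125 / 190 * (3 / 5) ^ 2 := by gcongr
      _ ≤ 1 / 4 := by norm_num
  have hθK : θ * (K * θ) ≤ 12 / 5 * (τ * r) := by
    have hk : (K : ℝ) ≤ 3 * Real.exp (K / 3 - 1) := by
      have := Real.add_one_le_exp (K / 3 - 1 : ℝ)
      linarith
    have h3 : Real.exp (K / 3 - 1) * (e * (Real.exp ((K + 2) / 3) * Real.exp ((K + 2) / 3))) =
        Real.exp (-(2 / 3)) := by
      rw [he, ← Real.exp_add, ← Real.exp_add, ← Real.exp_add]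
      congr 1
      ring
    calc θ * (K * θ) = K * (θ * θ) := by ring
      _ ≤ (3 * Real.exp (K / 3 - 1)) * ((125 / 114 * τ * Real.exp ((K + 2) / 3)) *
          (125 / 114 * (e * r) * Real.exp ((K + 2) / 3))) := by
          refine mul_le_mul hk (mul_le_mul hθ1 (hθ1.trans ?_) hθ0 (by positivity)) (by positivity)
            (by positivity)
          gcongr
      _ = 3 * (125 / 114) ^ 2 * (τ * r) * (Real.exp (K / 3 - 1) *
          (e * (Real.exp ((K + 2) / 3) * Real.exp ((K + 2) / 3)))) := by ring
      _ = 3 * (125 / 114) ^ 2 * (τ * r) * Real.exp (-(2 / 3)) := by rw [h3]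
      _ ≤ 3 * (125 / 114) ^ 2 * (τ * r) * (3 / 5) := by gcongr
      _ ≤ 12 / 5 * (τ * r) := by nlinarith [mul_pos hτ hr]
  have hpow : (1 + θ) ^ K - 1 ≤ K * θ * (5 / 4) := by
    have h1 : (1 + θ) ^ K ≤ Real.exp (K * θ) := by
      rw [Real.exp_nat_mul]
      gcongr
      rw [add_comm]
      exact Real.add_one_le_exp θ
    have hKθ0 : 0 ≤ K * θ := by positivity
    have h2 := Real.abs_exp_sub_one_sub_id_le (x := K * θ) (by rw [abs_of_nonneg hKθ0]; linarith)
    have h3 := (abs_le.1 h2).2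
    nlinarith
  calc θ * ((1 + θ) ^ K - 1) ≤ θ * (K * θ * (5 / 4)) := by gcongr
    _ = 5 / 4 * (θ * (K * θ)) := by ring
    _ ≤ 5 / 4 * (12 / 5 * (τ * r)) := by gcongr
    _ = _ := by ring

variable {d : ℕ}

/-- The second moment of the difference of two Gaussian densities vanishes linearly with the squared
distances of the means. -/
theorem integral_sq_sub_gaussianShift_le {v : ℝ≥0} (hv : v ≠ 0) {u w : EuclideanSpace ℝ (Fin d)}
    {r : ℝ} (hr1 : r ≤ 2 / 3) (hu : ‖u‖ ^ 2 / v ≤ r) (hw : ‖w‖ ^ 2 / v ≤ r)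
    (huw : ‖u - w‖ ^ 2 / v ≤ r) :
    Integrable (fun x => (gaussianShift v u x - gaussianShift v w x) ^ 2) (gaussianNoise d v) ∧
      ∫ x, (gaussianShift v u x - gaussianShift v w x) ^ 2 ∂gaussianNoise d v ≤ 7 / 3 * r := by
  obtain ⟨i1, e1⟩ := integrable_gaussianShift_pow hv u 2
  obtain ⟨i2, e2⟩ := integrable_gaussianShift_pow hv w 2
  obtain ⟨i3, e3⟩ := integrable_gaussianShift_mul hv u w
  have hexp : ∀ x, (gaussianShift v u x - gaussianShift v w x) ^ 2 = gaussianShift v u x ^ 2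
      + gaussianShift v w x ^ 2 - 2 * (gaussianShift v u x * gaussianShift v w x) :=
    fun x => by ring
  simp only [hexp]
  refine ⟨(i1.add i2).sub (i3.const_mul 2), ?_⟩
  have i12 : Integrable (fun x => gaussianShift v u x ^ 2 + gaussianShift v w x ^ 2)
      (gaussianNoise d v) := i1.add i2
  rw [integral_sub i12 (i3.const_mul 2), integral_add i1 i2, integral_const_mul, e1, e2, e3]
  have hexpand : ‖u - w‖ ^ 2 / v = ‖u‖ ^ 2 / v + ‖w‖ ^ 2 / v - 2 * (inner ℝ u w / v) := by
    rw [norm_sub_sq_real]; ring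
  have hu0 : 0 ≤ ‖u‖ ^ 2 / v := by positivity
  have hw0 : 0 ≤ ‖w‖ ^ 2 / v := by positivity
  rw [hexpand] at huw
  set A := ‖u‖ ^ 2 / (v : ℝ)
  set D := ‖w‖ ^ 2 / (v : ℝ)
  set B := inner ℝ u w / (v : ℝ)
  have hA := (abs_le.1 (Real.abs_exp_sub_one_sub_id_le (x := A)
    (by rw [abs_of_nonneg hu0]; linarith))).2
  have hD := (abs_le.1 (Real.abs_exp_sub_one_sub_id_le (x := D)
    (by rw [abs_of_nonneg hw0]; linarith))).2
  have hB := Real.add_one_le_exp B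
  norm_num
  nlinarith

theorem integral_gaussianShift_pow_le {v : ℝ≥0} (hv : v ≠ 0) {u : EuclideanSpace ℝ (Fin d)}
    {r : ℝ} (hr1 : r ≤ 2 / 3) (hu : ‖u‖ ^ 2 / v ≤ r) {j N : ℕ} (hj : j + 1 ≤ N) :
    ∫ x, gaussianShift v u x ^ (j + 1) ∂gaussianNoise d v ≤ Real.exp (N / 3) ^ j := by
  rw [(integrable_gaussianShift_pow hv u (j + 1)).2, ← Real.exp_nat_mul]
  apply Real.exp_le_exp.2
  have hjN : (j : ℝ) + 1 ≤ N := by exact_mod_cast hj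
  have hj0 : (0 : ℝ) ≤ j := Nat.cast_nonneg j
  push_cast
  calc ((j : ℝ) + 1) * (j + 1 - 1) / 2 * (‖u‖ ^ 2 / v) ≤ (N * j / 2) * (2 / 3) := by
        have : ((j : ℝ) + 1) * (j + 1 - 1) / 2 ≤ N * j / 2 := by nlinarith
        exact mul_le_mul this (hu.trans hr1) (by positivity) (by positivity)
    _ = _ := by ring

/-- Moments of integer order of the ratio of the densities `P = 1 - τ + τ ρ_u` and
`Q = 1 - τ + τ ρ_w`, where `ρ_u` is the density of `N(u, v I)` with respect to `N(0, v I)`. The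
constant `5 / 2` leaves room for the factor `2` lost in passing to real orders. -/
theorem integral_ratio_pow_le {v : ℝ≥0} (hv : v ≠ 0) {u w : EuclideanSpace ℝ (Fin d)}
    {r τ : ℝ} (hr : 0 < r) (hr1 : r ≤ 2 / 3) (hu : ‖u‖ ^ 2 / v ≤ r) (hw : ‖w‖ ^ 2 / v ≤ r)
    (huw : ‖u - w‖ ^ 2 / v ≤ r) (hτ : 0 < τ) {N : ℕ} (hN : 1 ≤ N)
    (h1 : τ * (1 + 1 / r) ≤ Real.exp (-1)) (h : τ * (1 + 1 / r) ≤ Real.exp (-(N - 1))) :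
    Integrable (fun x => ((1 - τ + τ * gaussianShift v u x) / (1 - τ + τ * gaussianShift v w x)) ^ N
        * (1 - τ + τ * gaussianShift v w x)) (gaussianNoise d v) ∧
      ∫ x, ((1 - τ + τ * gaussianShift v u x) / (1 - τ + τ * gaussianShift v w x)) ^ N
        * (1 - τ + τ * gaussianShift v w x) ∂gaussianNoise d v
        ≤ 1 + 5 / 2 * (N * (N - 1)) * (τ ^ 2 * r) := by
  have hτ5 : τ ≤ 1 / 5 := by
    have he : Real.exp (-1) ≤ 1 / 2 := by
      rw [Real.exp_neg, inv_le_comm₀ (Real.exp_pos _) (by norm_num)]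
      have := Real.add_one_le_exp (1 : ℝ)
      norm_num at this ⊢
      linarith
    have hr2 : 3 / 2 ≤ 1 / r := by
      rw [le_div_iff₀ hr]; linarith
    nlinarith
  have h1τ : 0 < 1 - τ := by linarith
  have hpos : ∀ z x, 0 < 1 - τ + τ * gaussianShift (d := d) v z x := fun z x => by
    have := gaussianShift_pos v z x
    positivity
  have hlin : ∀ z : EuclideanSpace ℝ (Fin d),
      Integrable (fun x => 1 - τ + τ * gaussianShift v z x) (gaussianNoise d v) ∧
      ∫ x, (1 - τ + τ * gaussianShift v z x) ∂gaussianNoise d v = 1 := by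
    intro z
    obtain ⟨i, e⟩ := integrable_gaussianShift hv z
    refine ⟨(integrable_const _).add (i.const_mul τ), ?_⟩
    rw [integral_add (integrable_const _) (i.const_mul τ), integral_const_mul, e]
    simp
  obtain rfl | ⟨K, rfl⟩ : N = 1 ∨ ∃ K, N = K + 2 := by
    rcases Nat.exists_eq_add_of_le hN with ⟨_ | K, rfl⟩
    · exact Or.inl rfl
    · exact Or.inr ⟨K, by ring⟩
  · have e : ∀ x, ((1 - τ + τ * gaussianShift v u x) / (1 - τ + τ * gaussianShift v w x)) ^ 1
        * (1 - τ + τ * gaussianShift v w x) = 1 - τ + τ * gaussianShift v u x := fun x => by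
      rw [pow_one, div_mul_cancel₀ _ (hpos w x).ne']
    simp only [e]
    exact ⟨(hlin u).1, by rw [(hlin u).2]; simp⟩
  obtain ⟨iu, eu⟩ := integrable_gaussianShift hv u
  obtain ⟨iw, ew⟩ := integrable_gaussianShift hv w
  obtain ⟨isq, esq⟩ := integral_sq_sub_gaussianShift_le hv hr1 hu hw huw
  have ipow : ∀ i : ℕ, Integrable (fun x => gaussianShift v u x ^ (i + 3)
      + gaussianShift v w x ^ (i + 3)) (gaussianNoise d v) := fun i =>
    (integrable_gaussianShift_pow hv u _).1.add (integrable_gaussianShift_pow hv w _).1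
  set t := τ / (1 - τ) with ht
  set F : EuclideanSpace ℝ (Fin d) → ℝ := fun x => ∑ i ∈ Finset.range K,
    ((K + 2).choose (i + 3) : ℝ) * (τ * t ^ (i + 2))
      * (gaussianShift v u x ^ (i + 3) + gaussianShift v w x ^ (i + 3)) with hF
  have iF : Integrable F (gaussianNoise d v) :=
    integrable_finsetSum _ fun i _ => (ipow i).const_mul _
  have ilin : Integrable (fun x => (K + 2) * τ * (gaussianShift v u x - gaussianShift v w x))
      (gaussianNoise d v) := (iu.sub iw).const_mul _
  have i12 : Integrable (fun x => (1 - τ + τ * gaussianShift v w x)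
      + (K + 2) * τ * (gaussianShift v u x - gaussianShift v w x)) (gaussianNoise d v) :=
    (hlin w).1.add ilin
  have i3 : Integrable (fun x => (K + 2) * (K + 1) / 2 * (τ ^ 2 / (1 - τ))
      * (gaussianShift v u x - gaussianShift v w x) ^ 2) (gaussianNoise d v) := isq.const_mul _
  have i123 : Integrable (fun x => (1 - τ + τ * gaussianShift v w x)
      + (K + 2) * τ * (gaussianShift v u x - gaussianShift v w x)
      + (K + 2) * (K + 1) / 2 * (τ ^ 2 / (1 - τ))
        * (gaussianShift v u x - gaussianShift v w x) ^ 2) (gaussianNoise d v) := i12.add i3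
  have iU := i123.add iF
  have hle : ∀ x, ((1 - τ + τ * gaussianShift v u x) / (1 - τ + τ * gaussianShift v w x)) ^ (K + 2)
      * (1 - τ + τ * gaussianShift v w x) ≤ (1 - τ + τ * gaussianShift v w x)
        + (K + 2) * τ * (gaussianShift v u x - gaussianShift v w x)
        + (K + 2) * (K + 1) / 2 * (τ ^ 2 / (1 - τ))
          * (gaussianShift v u x - gaussianShift v w x) ^ 2 + F x := fun x =>
    ratio_pow_mul_le (gaussianShift_pos v u x).le (gaussianShift_pos v w x).le hτ (by linarith) K
  have hint : Integrable (fun x => ((1 - τ + τ * gaussianShift v u x)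
      / (1 - τ + τ * gaussianShift v w x)) ^ (K + 2)
        * (1 - τ + τ * gaussianShift v w x)) (gaussianNoise d v) := by
    refine iU.mono' (by fun_prop) (Filter.Eventually.of_forall fun x => ?_)
    have := hpos u x
    have := hpos w x
    rw [Real.norm_of_nonneg (by positivity)]
    exact hle x
  refine ⟨hint, (integral_mono hint iU hle).trans ?_⟩
  have hUint : ∫ x, ((1 - τ + τ * gaussianShift v w x)
        + (K + 2) * τ * (gaussianShift v u x - gaussianShift v w x)
        + (K + 2) * (K + 1) / 2 * (τ ^ 2 / (1 - τ))
          * (gaussianShift v u x - gaussianShift v w x) ^ 2 + F x) ∂gaussianNoise d v =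
      1 + (K + 2) * (K + 1) / 2 * (τ ^ 2 / (1 - τ))
        * ∫ x, (gaussianShift v u x - gaussianShift v w x) ^ 2 ∂gaussianNoise d v
        + ∫ x, F x ∂gaussianNoise d v := by
    rw [integral_add i123 iF, integral_add i12 i3,
      integral_add (hlin w).1 ilin, integral_const_mul, integral_const_mul,
      integral_sub iu iw, eu, ew, (hlin w).2]
    simp
  refine (le_of_eq hUint).trans ?_
  have hsecond : (K + 2) * (K + 1) / 2 * (τ ^ 2 / (1 - τ))
        * ∫ x, (gaussianShift v u x - gaussianShift v w x) ^ 2 ∂gaussianNoise d v ≤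
      35 / 24 * ((K + 2) * (K + 1) * (τ ^ 2 * r)) := by
    have hq : τ ^ 2 / (1 - τ) ≤ 5 / 4 * τ ^ 2 := by
      rw [div_le_iff₀ h1τ]
      nlinarith [sq_nonneg τ]
    calc _ ≤ (K + 2) * (K + 1) / 2 * (5 / 4 * τ ^ 2) * (7 / 3 * r) := by gcongr
      _ = _ := by ring
  have htail : ∫ x, F x ∂gaussianNoise d v ≤ (K + 2) * (K + 1) * (τ ^ 2 * r) := by
    set θ := t * Real.exp ((K + 2) / 3) with hθ
    have ht0 : 0 ≤ t := by positivity
    have hθ0 : 0 ≤ θ := by positivity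
    have h2 : ∫ x, F x ∂gaussianNoise d v ≤
        2 * τ * ∑ i ∈ Finset.range K, ((K + 2).choose (i + 3) : ℝ) * θ ^ (i + 2) := by
      rw [hF, integral_finsetSum _ fun i _ => (ipow i).const_mul _, Finset.mul_sum]
      refine Finset.sum_le_sum fun i hi => ?_
      have hiK : i + 2 + 1 ≤ K + 2 := by have := Finset.mem_range.1 hi; omega
      have b1 := integral_gaussianShift_pow_le hv hr1 hu hiK
      have b2 := integral_gaussianShift_pow_le hv hr1 hw hiK
      push_cast at b1 b2
      rw [integral_const_mul, integral_add (integrable_gaussianShift_pow hv u _).1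
        (integrable_gaussianShift_pow hv w _).1]
      calc _ ≤ ((K + 2).choose (i + 3) : ℝ) * (τ * t ^ (i + 2)) *
            (Real.exp ((K + 2) / 3) ^ (i + 2) + Real.exp ((K + 2) / 3) ^ (i + 2)) := by gcongr
        _ = _ := by rw [hθ]; ring
    rcases Nat.eq_zero_or_pos K with rfl | hK
    · refine h2.trans ?_
      simp only [Finset.range_zero, Finset.sum_empty, mul_zero]
      positivity
    · have h3 := tail_le hr hr1 hτ hK (h.trans_eq (by push_cast; congr 1; ring))
      have h4 := sum_choose_mul_pow_le hθ0 K
      calc _ ≤ 2 * τ * ((K + 2) * (K + 1) / 6 * (3 * (τ * r))) := by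
            refine h2.trans ?_
            gcongr
            refine h4.trans ?_
            gcongr
        _ = _ := by ring
  have hfin : 0 ≤ ((K : ℝ) + 2) * (K + 1) * (τ ^ 2 * r) := by positivity
  push_cast
  nlinarith

/-- Moments of real order `α > 1`, by interpolation between the integers `⌊α⌋` and `⌊α⌋ + 1`; this
costs at most a factor `2`. -/
theorem lintegral_ratio_rpow_le {v : ℝ≥0} (hv : v ≠ 0) {u w : EuclideanSpace ℝ (Fin d)}
    {r τ α : ℝ} (hr : 0 < r) (hr1 : r ≤ 2 / 3) (hu : ‖u‖ ^ 2 / v ≤ r) (hw : ‖w‖ ^ 2 / v ≤ r)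
    (huw : ‖u - w‖ ^ 2 / v ≤ r) (hτ : 0 < τ) (hα : 1 < α)
    (h : τ * (1 + 1 / r) ≤ Real.exp (-α)) :
    ∫⁻ x, ENNReal.ofReal
      (((1 - τ + τ * gaussianShift v u x) / (1 - τ + τ * gaussianShift v w x)) ^ α
        * (1 - τ + τ * gaussianShift v w x)) ∂gaussianNoise d v
      ≤ ENNReal.ofReal (Real.exp (5 * α * (α - 1) * (τ ^ 2 * r))) := by
  set m := ⌊α⌋₊ with hm
  have hmα : (m : ℝ) ≤ α := Nat.floor_le (by linarith)
  have hαm : α < m + 1 := Nat.lt_floor_add_one α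
  have hm1 : 1 ≤ m := Nat.one_le_floor_iff α |>.2 hα.le
  have hmR : (1 : ℝ) ≤ m := by exact_mod_cast hm1
  have h1 : τ * (1 + 1 / r) ≤ Real.exp (-1) := h.trans (Real.exp_le_exp.2 (by linarith))
  obtain ⟨i0, e0⟩ := integral_ratio_pow_le hv hr hr1 hu hw huw hτ hm1 h1
    (h.trans (Real.exp_le_exp.2 (by linarith)))
  obtain ⟨i1, e1⟩ := integral_ratio_pow_le hv hr hr1 hu hw huw hτ (N := m + 1) (by omega) h1
    (h.trans (Real.exp_le_exp.2 (by push_cast; linarith)))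
  have hτ1 : τ < 1 := by
    have : Real.exp (-1) < 1 := Real.exp_lt_one_iff.2 (by norm_num)
    have : 0 < 1 / r := by positivity
    nlinarith
  have hpos : ∀ z x, 0 < 1 - τ + τ * gaussianShift (d := d) v z x := fun z x => by
    have := gaussianShift_pos v z x
    have : 0 < 1 - τ := by linarith
    positivity
  have hpt : ∀ x : EuclideanSpace ℝ (Fin d),
      ((1 - τ + τ * gaussianShift v u x) / (1 - τ + τ * gaussianShift v w x)) ^ α
        * (1 - τ + τ * gaussianShift v w x) ≤
      (m + 1 - α) * (((1 - τ + τ * gaussianShift v u x) / (1 - τ + τ * gaussianShift v w x)) ^ m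
        * (1 - τ + τ * gaussianShift v w x)) +
      (α - m) * (((1 - τ + τ * gaussianShift v u x) / (1 - τ + τ * gaussianShift v w x)) ^ (m + 1)
        * (1 - τ + τ * gaussianShift v w x)) := by
    intro x
    have hQ := hpos w x
    have hX : 0 < (1 - τ + τ * gaussianShift v u x) / (1 - τ + τ * gaussianShift v w x) :=
      div_pos (hpos u x) hQ
    set X := (1 - τ + τ * gaussianShift v u x) / (1 - τ + τ * gaussianShift v w x)
    have key := Real.geom_mean_le_arith_mean2_weighted (w₁ := m + 1 - α) (w₂ := α - m)
      (by linarith) (by linarith) (pow_nonneg hX.le m) (pow_nonneg hX.le (m + 1)) (by ring)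
    rw [← Real.rpow_natCast, ← Real.rpow_natCast, ← Real.rpow_mul hX.le, ← Real.rpow_mul hX.le,
      ← Real.rpow_add hX] at key
    rw [show (m : ℝ) * (m + 1 - α) + ((m + 1 : ℕ) : ℝ) * (α - m) = α by push_cast; ring,
      Real.rpow_natCast, Real.rpow_natCast] at key
    calc X ^ α * _ ≤ ((m + 1 - α) * X ^ m + (α - m) * X ^ (m + 1)) *
          (1 - τ + τ * gaussianShift v w x) := by gcongr
      _ = _ := by ring
  have iV := (i0.const_mul (m + 1 - α)).add (i1.const_mul (α - m))
  refine (lintegral_mono fun x => ENNReal.ofReal_le_ofReal (hpt x)).trans ?_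
  refine (ofReal_integral_eq_lintegral_ofReal iV
    (Filter.Eventually.of_forall fun x => ?_)).symm.trans_le ?_
  · have hQ := hpos w x
    have hX := div_pos (hpos u x) hQ
    have : 0 ≤ (m : ℝ) + 1 - α := by linarith
    have : 0 ≤ α - (m : ℝ) := by linarith
    simp only [Pi.add_apply, Pi.zero_apply]
    positivity
  · apply ENNReal.ofReal_le_ofReal
    refine le_trans ?_ (Real.add_one_le_exp _)
    simp only [Pi.add_apply]
    rw [integral_add (i0.const_mul _) (i1.const_mul _), integral_const_mul, integral_const_mul]
    have b0 := mul_le_mul_of_nonneg_left e0 (by linarith : 0 ≤ (m : ℝ) + 1 - α)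
    have b1 := mul_le_mul_of_nonneg_left e1 (by linarith : 0 ≤ α - (m : ℝ))
    -- The interpolated quantity `N (N - 1)` is at most `2 α (α - 1)`.
    have hcomb : ((m : ℝ) + 1 - α) * (m * (m - 1)) + (α - m) * ((m + 1) * m) ≤
        2 * (α * (α - 1)) := by
      nlinarith [mul_nonneg (by linarith : 0 ≤ (m : ℝ) - 1) (by linarith : 0 ≤ (m : ℝ)),
        mul_nonneg (by linarith : 0 ≤ (m : ℝ) - 1) (by linarith : 0 ≤ α - (m : ℝ)),
        mul_nonneg (by linarith : 0 ≤ α - (m : ℝ)) (by linarith : 0 ≤ α - (m : ℝ))]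
    have hc : 0 ≤ τ ^ 2 * r := by positivity
    have := mul_le_mul_of_nonneg_right hcomb hc
    push_cast at b1
    nlinarith

end MomentBounds

/-! ### Subsampling without replacement -/

section Subsampling

variable {d : ℕ}

theorem gaussian_mixture_eq_map {v : ℝ≥0} (hv : v ≠ 0) {τ : ℝ} (hτ : 0 ≤ τ) (hτ1 : τ ≤ 1)
    (a p : EuclideanSpace ℝ (Fin d)) :
    ENNReal.ofReal (1 - τ) • (gaussianNoise d v).map (fun x => a + x)
      + ENNReal.ofReal τ • (gaussianNoise d v).map (fun x => p + x) =
    ((gaussianNoise d v).withDensity fun x =>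
      ENNReal.ofReal (1 - τ + τ * gaussianShift v (p - a) x)).map fun x => a + x := by
  have hdens : ((gaussianNoise d v).withDensity fun x =>
      ENNReal.ofReal (1 - τ + τ * gaussianShift v (p - a) x)) =
      ENNReal.ofReal (1 - τ) • gaussianNoise d v
        + ENNReal.ofReal τ • (gaussianNoise d v).map (fun x => (p - a) + x) := by
    rw [map_add_gaussianNoise hv, ← withDensity_smul _ (by fun_prop), ← withDensity_const,
      ← withDensity_add_left (by fun_prop)]
    congr 1
    ext x
    have := (gaussianShift_pos v (p - a) x).le
    rw [Pi.add_apply, Pi.smul_apply, smul_eq_mul, ← ENNReal.ofReal_mul hτ,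
      ENNReal.ofReal_add (by linarith) (by positivity)]
  rw [hdens, Measure.map_add _ _ (by fun_prop), Measure.map_smul, Measure.map_smul,
    Measure.map_map (by fun_prop) (by fun_prop)]
  congr 4
  ext1 x
  simp only [Function.comp_apply]
  abel

/-- Two Gaussian mixtures with the same dominant component `N(a, v I)` and perturbations `N(p, v I)`
and `N(q, v I)` of weight `τ`. -/
theorem momentDominated_gaussian_mixture {v : ℝ≥0} (hv : v ≠ 0) {α β r τ : ℝ}
    (hα : α.HolderConjugate β) (hr : 0 < r) (hr1 : r ≤ 2 / 3) (hτ : 0 < τ)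
    (h : τ * (1 + 1 / r) ≤ Real.exp (-α)) {a p q : EuclideanSpace ℝ (Fin d)}
    (hp : ‖p - a‖ ^ 2 / v ≤ r) (hq : ‖q - a‖ ^ 2 / v ≤ r) (hpq : ‖p - q‖ ^ 2 / v ≤ r) :
    MomentDominated β (ENNReal.ofReal (Real.exp (5 * α * (α - 1) * (τ ^ 2 * r))) ^ (1 / α))
      (ENNReal.ofReal (1 - τ) • (gaussianNoise d v).map (fun x => a + x)
        + ENNReal.ofReal τ • (gaussianNoise d v).map (fun x => p + x))
      (ENNReal.ofReal (1 - τ) • (gaussianNoise d v).map (fun x => a + x)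
        + ENNReal.ofReal τ • (gaussianNoise d v).map (fun x => q + x)) := by
  have hτ1 : τ < 1 := by
    have : Real.exp (-α) < 1 := Real.exp_lt_one_iff.2 (by linarith [hα.pos])
    have : 0 < 1 / r := by positivity
    nlinarith
  have hpos : ∀ z x, 0 < 1 - τ + τ * gaussianShift (d := d) v z x := fun z x => by
    have := gaussianShift_pos v z x
    have : 0 < 1 - τ := by linarith
    positivity
  rw [gaussian_mixture_eq_map hv hτ.le hτ1.le, gaussian_mixture_eq_map hv hτ.le hτ1.le]
  refine (momentDominated_withDensity hα _ (by fun_prop) (by fun_prop) (fun x => (hpos _ x).le)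
    (hpos _) ?_).map (by fun_prop)
  exact lintegral_ratio_rpow_le hv hr hr1 hp hq (by rwa [sub_sub_sub_cancel_right]) hτ hα.lt h

variable {n : ℕ}

/-- Double counting of the exchanges of the index `i₀` for another one. -/
theorem sum_powersetCard_mem_eq {M : Type*} [AddCommMonoid M] (b : ℕ) (i₀ : Fin n)
    (h : Finset (Fin n) → M) :
    (n - b) • ∑ B ∈ (Finset.powersetCard b Finset.univ).filter (i₀ ∈ ·), h B =
      ∑ B ∈ (Finset.powersetCard b Finset.univ).filter (i₀ ∉ ·), ∑ j ∈ B,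
        h (insert i₀ (B.erase j)) := by
  have h1 : (n - b) • ∑ B ∈ (Finset.powersetCard b Finset.univ).filter (i₀ ∈ ·), h B =
      ∑ B ∈ (Finset.powersetCard b Finset.univ).filter (i₀ ∈ ·), ∑ _j ∈ Bᶜ, h B := by
    rw [Finset.smul_sum]
    refine Finset.sum_congr rfl fun B hB => ?_
    have hBc : B.card = b := (Finset.mem_powersetCard.1 (Finset.mem_filter.1 hB).1).2
    rw [Finset.sum_const, Finset.card_compl, Fintype.card_fin, hBc]
  rw [h1, Finset.sum_sigma', Finset.sum_sigma']
  refine Finset.sum_bij' (fun x _ => ⟨insert x.2 (x.1.erase i₀), x.2⟩)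
    (fun x _ => ⟨insert i₀ (x.1.erase x.2), x.2⟩) ?_ ?_ ?_ ?_ ?_
  · rintro ⟨B, j⟩ hx
    simp only [Finset.mem_sigma, Finset.mem_filter, Finset.mem_powersetCard, Finset.subset_univ,
      true_and, Finset.mem_compl] at hx ⊢
    obtain ⟨⟨hc, hi⟩, hj⟩ := hx
    have hne : i₀ ≠ j := fun e => hj (e ▸ hi)
    refine ⟨⟨?_, by simp [hne]⟩, Finset.mem_insert_self _ _⟩
    rw [Finset.card_insert_of_notMem (by simp [hj]), Finset.card_erase_add_one hi, hc]
  · rintro ⟨B, j⟩ hx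
    simp only [Finset.mem_sigma, Finset.mem_filter, Finset.mem_powersetCard, Finset.subset_univ,
      true_and, Finset.mem_compl] at hx ⊢
    obtain ⟨⟨hc, hi⟩, hj⟩ := hx
    have hne : j ≠ i₀ := fun e => hi (e ▸ hj)
    refine ⟨⟨?_, Finset.mem_insert_self _ _⟩, by simp [hne]⟩
    rw [Finset.card_insert_of_notMem (by simp [hi]), Finset.card_erase_add_one hj, hc]
  · rintro ⟨B, j⟩ hx
    simp only [Finset.mem_sigma, Finset.mem_filter, Finset.mem_compl] at hx
    simp only [Sigma.mk.injEq, heq_eq_eq, and_true]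
    rw [Finset.erase_insert (by simp [hx.2]), Finset.insert_erase hx.1.2]
  · rintro ⟨B, j⟩ hx
    simp only [Finset.mem_sigma, Finset.mem_filter] at hx
    simp only [Sigma.mk.injEq, heq_eq_eq, and_true]
    rw [Finset.erase_insert (by simp [hx.1.2]), Finset.insert_erase hx.2]
  · rintro ⟨B, j⟩ hx
    simp only [Finset.mem_sigma, Finset.mem_filter, Finset.mem_compl] at hx
    simp only
    rw [Finset.erase_insert (by simp [hx.2]), Finset.insert_erase hx.1.2]

/-- A uniformly distributed `b`-element subset is obtained from a uniformly distributed `b`-element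
subset `B` of the complement of `i₀` by exchanging, with probability `b / n`, a random element of
`B` for `i₀`. -/
theorem average_powersetCard_eq {M : Type*} [AddCommMonoid M] [Module ℝ≥0∞ M] {b : ℕ} (hb : 0 < b)
    (hbn : b < n) (i₀ : Fin n) (h : Finset (Fin n) → M) :
    (n.choose b : ℝ≥0∞)⁻¹ • ∑ B ∈ Finset.powersetCard b (Finset.univ : Finset (Fin n)), h B =
      ∑ x ∈ ((Finset.powersetCard b Finset.univ).filter (i₀ ∉ ·)).sigma fun B => B,
        ENNReal.ofReal (b * (n - 1).choose b : ℝ)⁻¹ •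
          (ENNReal.ofReal (1 - b / n) • h x.1
            + ENNReal.ofReal (b / n) • h (insert i₀ (x.1.erase x.2))) := by
  have hb' : (0 : ℝ) < b := by exact_mod_cast hb
  have hbn' : (b : ℝ) < n := by exact_mod_cast hbn
  have hn' : (0 : ℝ) < n := hb'.trans hbn'
  have hC : (0 : ℝ) < n.choose b := by exact_mod_cast Nat.choose_pos hbn.le
  have hC1 : (0 : ℝ) < (n - 1).choose b := by exact_mod_cast Nat.choose_pos (by omega)
  have hch : ((n - 1).choose b : ℝ) * n = n.choose b * (n - b) := by
    obtain ⟨m, rfl⟩ : ∃ m, n = m + 1 := ⟨n - 1, by omega⟩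
    have := Nat.choose_mul_succ_eq m b
    rw [← Nat.cast_sub hbn.le]
    exact_mod_cast this
  have hτ1 : 0 ≤ 1 - (b : ℝ) / n := by
    rw [sub_nonneg, div_le_one hn']; exact hbn'.le
  have hCe : (n.choose b : ℝ≥0∞)⁻¹ = ENNReal.ofReal (n.choose b : ℝ)⁻¹ := by
    rw [ENNReal.ofReal_inv_of_pos hC, ENNReal.ofReal_natCast]
  have w1 : ENNReal.ofReal (b * (n - 1).choose b : ℝ)⁻¹ * (ENNReal.ofReal (1 - b / n) * b) =
      (n.choose b : ℝ≥0∞)⁻¹ := by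
    rw [hCe, ← ENNReal.ofReal_natCast b, ← ENNReal.ofReal_mul hτ1,
      ← ENNReal.ofReal_mul (by positivity)]
    congr 1
    field_simp
    linear_combination -hch
  have w2 : ENNReal.ofReal (b * (n - 1).choose b : ℝ)⁻¹ *
      (ENNReal.ofReal (b / n) * (n - b : ℕ)) = (n.choose b : ℝ≥0∞)⁻¹ := by
    rw [hCe, ← ENNReal.ofReal_natCast (n - b), Nat.cast_sub hbn.le,
      ← ENNReal.ofReal_mul (by positivity), ← ENNReal.ofReal_mul (by positivity)]
    congr 1
    field_simp
    linear_combination -hch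
  have hnot : ∑ B ∈ (Finset.powersetCard b Finset.univ).filter (i₀ ∉ ·), ∑ _j ∈ B, h B =
      (b : ℝ≥0∞) • ∑ B ∈ (Finset.powersetCard b Finset.univ).filter (i₀ ∉ ·), h B := by
    rw [Finset.smul_sum]
    refine Finset.sum_congr rfl fun B hB => ?_
    have hBc : B.card = b := (Finset.mem_powersetCard.1 (Finset.mem_filter.1 hB).1).2
    rw [Finset.sum_const, hBc, Nat.cast_smul_eq_nsmul]
  rw [← Finset.smul_sum, Finset.sum_add_distrib, ← Finset.smul_sum, ← Finset.smul_sum,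
    Finset.sum_sigma, Finset.sum_sigma, hnot, ← sum_powersetCard_mem_eq,
    ← Nat.cast_smul_eq_nsmul ℝ≥0∞, smul_add, smul_smul, smul_smul, smul_smul, smul_smul,
    mul_assoc, mul_assoc, w1, w2, ← smul_add, add_comm, Finset.sum_filter_add_sum_filter_not]

/-- Privacy amplification by subsampling without replacement for the Gaussian mechanism. The query
values `c B` and `c' B` on the minibatch `B` differ only if `i₀ ∈ B`. -/
theorem momentDominated_subsampled_gaussian {v : ℝ≥0} (hv : v ≠ 0) {b : ℕ} (hb : 0 < b)
    (hbn : b < n) {α β r : ℝ} (hα : α.HolderConjugate β) (hr : 0 < r) (hr1 : r ≤ 2 / 3)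
    (h : (b / n : ℝ) * (1 + 1 / r) ≤ Real.exp (-α)) (i₀ : Fin n)
    {c c' : Finset (Fin n) → EuclideanSpace ℝ (Fin d)} (hcc : ∀ B, i₀ ∉ B → c B = c' B)
    (hc : ∀ B, ∀ j ∈ B, i₀ ∉ B → ‖c (insert i₀ (B.erase j)) - c B‖ ^ 2 / v ≤ r)
    (hc' : ∀ B, ∀ j ∈ B, i₀ ∉ B → ‖c' (insert i₀ (B.erase j)) - c' B‖ ^ 2 / v ≤ r)
    (hd : ∀ B, i₀ ∈ B → ‖c B - c' B‖ ^ 2 / v ≤ r) :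
    MomentDominated β
      (ENNReal.ofReal (Real.exp (5 * α * (α - 1) * ((b / n : ℝ) ^ 2 * r))) ^ (1 / α))
      ((n.choose b : ℝ≥0∞)⁻¹ • ∑ B ∈ Finset.powersetCard b (Finset.univ : Finset (Fin n)),
        (gaussianNoise d v).map fun x => c B + x)
      ((n.choose b : ℝ≥0∞)⁻¹ • ∑ B ∈ Finset.powersetCard b (Finset.univ : Finset (Fin n)),
        (gaussianNoise d v).map fun x => c' B + x) := by
  have hn : 0 < n := hb.trans hbn
  have hτ : (0 : ℝ) < b / n := by positivity
  have hτ1 : (b / n : ℝ) ≤ 1 := by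
    rw [div_le_one (by positivity)]; exact_mod_cast hbn.le
  rw [average_powersetCard_eq hb hbn i₀, average_powersetCard_eq hb hbn i₀]
  refine MomentDominated.sum hα.symm.lt.le _ _ ?_ fun x hx => ?_
  · -- The weights are those of the constant function `1`.
    have h1 := average_powersetCard_eq hb hbn i₀ fun _ => (1 : ℝ≥0∞)
    simp only [smul_eq_mul, mul_one, Finset.sum_const, Finset.card_powersetCard, Finset.card_univ,
      Fintype.card_fin, nsmul_eq_mul] at h1
    rw [← ENNReal.ofReal_add (by linarith) hτ.le, sub_add_cancel, ENNReal.ofReal_one, mul_one,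
      ENNReal.inv_mul_cancel (by exact_mod_cast (Nat.choose_pos hbn.le).ne')
        (ENNReal.natCast_ne_top _)] at h1
    rw [Finset.sum_const, nsmul_eq_mul, ← h1]
  · obtain ⟨B, j⟩ := x
    simp only [Finset.mem_sigma, Finset.mem_filter] at hx
    obtain ⟨⟨-, hi⟩, hj⟩ := hx
    simp only
    have h1 := hc B j hj hi
    have h2 := hc' B j hj hi
    rw [← hcc B hi] at h2 ⊢
    exact momentDominated_gaussian_mixture hv hα hr hr1 hτ h h1 h2
      (hd _ (Finset.mem_insert_self _ _))

end Subsampling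

/-! ### The steps of DP-LSSGD -/

section Mechanism

variable {Z : Type*} {d n : ℕ}

/-- The law of the iterate that follows the iterate `w`. -/
noncomputable def stepLaw (loss : EuclideanSpace ℝ (Fin d) → Z → ℝ) (σ : ℝ) (b : ℕ) (η : ℝ)
    (v : ℝ≥0) (S : Fin n → Z) (w : EuclideanSpace ℝ (Fin d)) : Measure (EuclideanSpace ℝ (Fin d)) :=
  (n.choose b : ℝ≥0∞)⁻¹ • ∑ B ∈ Finset.powersetCard b (Finset.univ : Finset (Fin n)),
    (gaussianNoise d v).map fun ξ => update loss σ b η S B w ξ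

theorem stepLaw_apply (loss : EuclideanSpace ℝ (Fin d) → Z → ℝ) (σ : ℝ) (b : ℕ) (η : ℝ) (v : ℝ≥0)
    (S : Fin n → Z) (w : EuclideanSpace ℝ (Fin d)) {s : Set (EuclideanSpace ℝ (Fin d))}
    (hs : MeasurableSet s) :
    stepLaw loss σ b η v S w s = (n.choose b : ℝ≥0∞)⁻¹ *
      ∑ B ∈ Finset.powersetCard b (Finset.univ : Finset (Fin n)),
        gaussianNoise d v (Prod.mk w ⁻¹' ((fun p => update loss σ b η S B p.1 p.2) ⁻¹' s)) := by
  rw [stepLaw, Measure.smul_apply, Measure.finsetSum_apply, smul_eq_mul]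
  congr 1
  refine Finset.sum_congr rfl fun B _ => ?_
  exact Measure.map_apply ((measurable_update loss σ b η S B).comp measurable_prodMk_left) hs

theorem measurable_stepLaw (loss : EuclideanSpace ℝ (Fin d) → Z → ℝ) (σ : ℝ) (b : ℕ) (η : ℝ)
    (v : ℝ≥0) (S : Fin n → Z) : Measurable (stepLaw loss σ b η v S) := by
  refine Measure.measurable_of_measurable_coe _ fun s hs => ?_
  simp only [stepLaw_apply loss σ b η v S _ hs]
  exact (Finset.measurable_fun_sum _ fun B _ =>
    measurable_measure_prodMk_left (measurable_update loss σ b η S B hs)).const_mul _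

theorem iterateLaw_succ (loss : EuclideanSpace ℝ (Fin d) → Z → ℝ) (σ : ℝ) (b : ℕ) (η : ℕ → ℝ)
    (v : ℝ≥0) (w₀ : EuclideanSpace ℝ (Fin d)) (S : Fin n → Z) (k : ℕ) :
    iterateLaw loss σ b η v w₀ S (k + 1) =
      (iterateLaw loss σ b η v w₀ S k).bind (stepLaw loss σ b (η k) v S) := by
  ext s hs
  rw [Measure.bind_apply hs (measurable_stepLaw loss σ b (η k) v S).aemeasurable, iterateLaw,
    Measure.smul_apply, Measure.finsetSum_apply, smul_eq_mul]
  simp only [stepLaw_apply loss σ b (η k) v S _ hs]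
  have hm : ∀ B, MeasurableSet ((fun p : EuclideanSpace ℝ (Fin d) × EuclideanSpace ℝ (Fin d) =>
      update loss σ b (η k) S B p.1 p.2) ⁻¹' s) := fun B => measurable_update loss σ b (η k) S B hs
  rw [lintegral_const_mul _ (Finset.measurable_fun_sum _ fun B _ =>
    measurable_measure_prodMk_left (hm B)), lintegral_finsetSum _ fun B _ =>
    measurable_measure_prodMk_left (hm B)]
  congr 1
  refine Finset.sum_congr rfl fun B _ => ?_
  rw [Measure.map_apply (measurable_update loss σ b (η k) S B) hs, Measure.prod_apply (hm B)]

theorem norm_gradient_le {f : EuclideanSpace ℝ (Fin d) → ℝ} {G : ℝ≥0} (hf : LipschitzWith G f)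
    (w : EuclideanSpace ℝ (Fin d)) : ‖gradient f w‖ ≤ G := by
  rw [gradient, LinearIsometryEquiv.norm_map]
  exact norm_fderiv_le_of_lipschitz ℝ hf

variable {loss : EuclideanSpace ℝ (Fin d) → Z → ℝ} {G : ℝ≥0}

theorem batchGradient_congr (b : ℕ) {S S' : Fin n → Z} {B : Finset (Fin n)}
    (h : ∀ i ∈ B, S i = S' i) (w : EuclideanSpace ℝ (Fin d)) :
    batchGradient loss b S B w = batchGradient loss b S' B w := by
  rw [batchGradient, batchGradient, Finset.sum_congr rfl fun i hi => by rw [h i hi]]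

theorem norm_smul_sub_le (hloss : ∀ z, LipschitzWith G fun w => loss w z) (b : ℕ) (z z' : Z)
    (w : EuclideanSpace ℝ (Fin d)) :
    ‖(1 / (b : ℝ)) • (gradient (fun v => loss v z) w - gradient (fun v => loss v z') w)‖ ≤
      2 * G / b := by
  have h := (norm_sub_le (gradient (fun v => loss v z) w) (gradient (fun v => loss v z') w)).trans
    (add_le_add (norm_gradient_le (hloss z) w) (norm_gradient_le (hloss z') w))
  rw [norm_smul, Real.norm_of_nonneg (by positivity), one_div_mul_eq_div]
  gcongr
  linarith

theorem norm_batchGradient_exchange_le (hloss : ∀ z, LipschitzWith G fun w => loss w z) (b : ℕ)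
    (S : Fin n → Z) {B : Finset (Fin n)} {i j : Fin n} (hj : j ∈ B) (hi : i ∉ B)
    (w : EuclideanSpace ℝ (Fin d)) :
    ‖batchGradient loss b S (insert i (B.erase j)) w - batchGradient loss b S B w‖ ≤ 2 * G / b := by
  rw [batchGradient, batchGradient, ← smul_sub, Finset.sum_insert (by simp [hi]),
    ← Finset.add_sum_erase B _ hj, add_sub_add_right_eq_sub]
  exact norm_smul_sub_le hloss b _ _ w

theorem norm_batchGradient_sub_le (hloss : ∀ z, LipschitzWith G fun w => loss w z) (b : ℕ)
    {S S' : Fin n → Z} {B : Finset (Fin n)} {i : Fin n} (hi : i ∈ B) (h : ∀ j, j ≠ i → S j = S' j)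
    (w : EuclideanSpace ℝ (Fin d)) :
    ‖batchGradient loss b S B w - batchGradient loss b S' B w‖ ≤ 2 * G / b := by
  have he : ∑ j ∈ B.erase i, gradient (fun v => loss v (S j)) w =
      ∑ j ∈ B.erase i, gradient (fun v => loss v (S' j)) w :=
    Finset.sum_congr rfl fun j hj => by rw [h j (Finset.ne_of_mem_erase hj)]
  rw [batchGradient, batchGradient, ← smul_sub, ← Finset.add_sum_erase B _ hi,
    ← Finset.add_sum_erase B (fun j => gradient (fun v => loss v (S' j)) w) hi, he,
    add_sub_add_right_eq_sub]
  exact norm_smul_sub_le hloss b _ _ w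

/-- A step is a measurable function of the noisy minibatch gradient, whatever the matrix `A_σ` and
the step size are. -/
theorem stepLaw_eq_map (σ : ℝ) (b : ℕ) (η : ℝ) (v : ℝ≥0) (S : Fin n → Z)
    (w : EuclideanSpace ℝ (Fin d)) :
    stepLaw loss σ b η v S w = ((n.choose b : ℝ≥0∞)⁻¹ •
      ∑ B ∈ Finset.powersetCard b (Finset.univ : Finset (Fin n)),
        (gaussianNoise d v).map fun ξ => batchGradient loss b S B w + ξ).map
      fun y => w - η • Matrix.toEuclideanLin (smoothingMatrix d σ)⁻¹ y := by
  have hA : Measurable (Matrix.toEuclideanLin (smoothingMatrix d σ)⁻¹) :=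
    (LinearMap.continuous_of_finiteDimensional _).measurable
  have hm : Measurable fun y => w - η • Matrix.toEuclideanLin (smoothingMatrix d σ)⁻¹ y :=
    measurable_const.sub (hA.const_smul η)
  rw [stepLaw, Measure.map_smul, Measure.map_finset_sum hm.aemeasurable]
  congr 1
  refine Finset.sum_congr rfl fun B _ => ?_
  rw [Measure.map_map hm (by fun_prop)]
  rfl

/-- One step of DP-LSSGD on two datasets that differ only at `i₀`. -/
theorem momentDominated_stepLaw (hloss : ∀ z, LipschitzWith G fun w => loss w z) {v : ℝ≥0}
    (hv : v ≠ 0) {b : ℕ} (hb : 0 < b) (hbn : b < n) {α β r : ℝ} (hα : α.HolderConjugate β)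
    (hr : 0 < r) (hr1 : r ≤ 2 / 3) (h : (b / n : ℝ) * (1 + 1 / r) ≤ Real.exp (-α))
    (hG : (2 * G / b : ℝ) ^ 2 / v ≤ r) {S S' : Fin n → Z} {i₀ : Fin n}
    (hS : ∀ j, j ≠ i₀ → S j = S' j) (σ η : ℝ) (w : EuclideanSpace ℝ (Fin d)) :
    MomentDominated β
      (ENNReal.ofReal (Real.exp (5 * α * (α - 1) * ((b / n : ℝ) ^ 2 * r))) ^ (1 / α))
      (stepLaw loss σ b η v S w) (stepLaw loss σ b η v S' w) := by
  have hA : Measurable (Matrix.toEuclideanLin (smoothingMatrix d σ)⁻¹) :=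
    (LinearMap.continuous_of_finiteDimensional _).measurable
  have hsq : ∀ {x : EuclideanSpace ℝ (Fin d)}, ‖x‖ ≤ 2 * G / b → ‖x‖ ^ 2 / v ≤ r := by
    intro x hx
    refine le_trans ?_ hG
    gcongr
  rw [stepLaw_eq_map, stepLaw_eq_map]
  refine (momentDominated_subsampled_gaussian hv hb hbn hα hr hr1 h i₀ ?_ ?_ ?_ ?_).map
    (measurable_const.sub (hA.const_smul η))
  · exact fun B hB => batchGradient_congr b (fun i hi => hS i fun e => hB (e ▸ hi)) w
  · exact fun B j hj hi => hsq (norm_batchGradient_exchange_le hloss b S hj hi w)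
  · exact fun B j hj hi => hsq (norm_batchGradient_exchange_le hloss b S' hj hi w)
  · exact fun B hB => hsq (norm_batchGradient_sub_le hloss b hB hS w)

theorem momentDominated_iterateLaw {β : ℝ} (hβ : 0 < β) {c : ℝ≥0∞} {v : ℝ≥0} {b : ℕ} {σ : ℝ}
    {S S' : Fin n → Z} (h : ∀ η w, MomentDominated β c (stepLaw loss σ b η v S w)
      (stepLaw loss σ b η v S' w)) (η : ℕ → ℝ) (w₀ : EuclideanSpace ℝ (Fin d)) (k : ℕ) :
    MomentDominated β (c ^ k) (iterateLaw loss σ b η v w₀ S k)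
      (iterateLaw loss σ b η v w₀ S' k) := by
  induction k with
  | zero =>
    rw [pow_zero]
    exact momentDominated_dirac hβ w₀
  | succ k ih =>
    rw [iterateLaw_succ, iterateLaw_succ, pow_succ]
    exact ih.bind hβ (measurable_stepLaw ..) (measurable_stepLaw ..) (h (η k))

/-- Constant losses have zero gradients, so the law of the iterates ignores the dataset. -/
theorem iterateLaw_eq_of_lipschitzWith_zero (hloss : ∀ z, LipschitzWith 0 fun w => loss w z)
    (σ : ℝ) (b : ℕ) (η : ℕ → ℝ) (v : ℝ≥0) (w₀ : EuclideanSpace ℝ (Fin d)) (S S' : Fin n → Z)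
    (k : ℕ) : iterateLaw loss σ b η v w₀ S k = iterateLaw loss σ b η v w₀ S' k := by
  have hg : ∀ z w, gradient (fun v => loss v z) w = 0 := fun z w =>
    norm_le_zero_iff.1 (norm_gradient_le (hloss z) w)
  induction k with
  | zero => rfl
  | succ k ih => simp only [iterateLaw, ih, update, batchGradient, hg]

end Mechanism

end DPLSSGD

/-- Privacy guarantee of DP-LSSGD. -/
theorem theorem1 {Z : Type*} {d : ℕ} (n b T : ℕ) (hb : 0 < b) (hbn : b ≤ n) (hT : 0 < T)
    (loss : EuclideanSpace ℝ (Fin d) → Z → ℝ) (G : ℝ≥0)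
    (hloss : ∀ z, LipschitzWith G (fun w => loss w z))
    (σ : ℝ) (hσ : 0 ≤ σ) (η : ℕ → ℝ) (w₀ : EuclideanSpace ℝ (Fin d))
    (ε δ : ℝ) (hε : 0 < ε) (hδ : 0 < δ)
    (μ : ℝ) (hμ : μ ∈ Set.Ioo (0 : ℝ) 1)
    (hα : DPLSSGD.order ε δ μ ≤
      Real.log (μ * n ^ 3 * ε / (5 * b ^ 3 * T * DPLSSGD.order ε δ μ + μ * b * n ^ 2 * ε)))
    (hν : 1.5 ≤ 5 * b ^ 2 * T * DPLSSGD.order ε δ μ / (μ * n ^ 2 * ε)) :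
    DPLSSGD.IsDifferentiallyPrivate
      (fun S : Fin n → Z => DPLSSGD.mechanism loss σ b T η
        (DPLSSGD.noiseVariance n T G ε δ μ).toNNReal w₀ S) ε δ := by
  open DPLSSGD in
  intro S S' hadj O hO
  have hprob : ∀ (v : ℝ≥0) (S : Fin n → Z),
      IsProbabilityMeasure (iterateLaw loss σ b η v w₀ S T) := fun v S =>
    isProbabilityMeasure_iterateLaw loss σ b hbn η v w₀ S T
  simp only [mechanism]
  have := hprob (noiseVariance n T G ε δ μ).toNNReal S
  have := hprob (noiseVariance n T G ε δ μ).toNNReal S'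
  rcases le_or_gt 1 δ with hδ1 | hδ1
  · calc _ ≤ (1 : ℝ≥0∞) := prob_le_one
      _ ≤ ENNReal.ofReal δ := ENNReal.one_le_ofReal.2 hδ1
      _ ≤ _ := le_add_self
  -- For `G = 0` the noise is a Dirac mass, to which the Cameron–Martin formula does not apply.
  rcases eq_or_ne G 0 with rfl | hG0
  · rw [iterateLaw_eq_of_lipschitzWith_zero hloss σ b η _ w₀ S S' T]
    refine le_add_right (le_mul_of_one_le_left zero_le ?_)
    exact ENNReal.one_le_ofReal.2 (Real.one_le_exp hε.le)
  obtain ⟨hμ0, hμ1⟩ := hμ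
  have hGpos : (0 : ℝ) < G := by exact_mod_cast pos_iff_ne_zero.2 hG0
  have hbR : (0 : ℝ) < b := by exact_mod_cast hb
  have hTR : (0 : ℝ) < T := by exact_mod_cast hT
  have hnR : (0 : ℝ) < n := by exact_mod_cast hb.trans_le hbn
  have hlog : 0 < Real.log (1 / δ) := Real.log_pos (by rwa [one_lt_div hδ])
  have h1μ : 0 < 1 - μ := by linarith
  have hα1 : 1 < order ε δ μ := by
    have : 0 < Real.log (1 / δ) / ((1 - μ) * ε) := by positivity
    rw [order]; linarith
  have hκ : μ * ε + Real.log (1 / δ) / (order ε δ μ - 1) = ε := by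
    rw [order, add_sub_cancel_right]
    field_simp
    ring
  have hvdef : noiseVariance n T G ε δ μ = 20 * T * order ε δ μ * G ^ 2 / (μ * n ^ 2 * ε) := rfl
  set α := order ε δ μ
  have hα0 : 0 < α := by linarith
  have hvpos : 0 < noiseVariance n T G ε δ μ := by rw [hvdef]; positivity
  set v := (noiseVariance n T G ε δ μ).toNNReal with hv
  have hvR : (v : ℝ) = 20 * T * α * G ^ 2 / (μ * n ^ 2 * ε) := by
    rw [hv, Real.coe_toNNReal _ hvpos.le, hvdef]
  have hv0 : v ≠ 0 := (Real.toNNReal_pos.2 hvpos).ne'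
  -- The squared sensitivity `(2 G / b) ^ 2` of the minibatch gradient, in units of the variance.
  set r : ℝ := μ * n ^ 2 * ε / (5 * b ^ 2 * T * α) with hr
  have hr0 : 0 < r := by positivity
  have hrinv : 1 / r = 5 * b ^ 2 * T * α / (μ * n ^ 2 * ε) := by rw [hr, one_div_div]
  have hr1 : r ≤ 2 / 3 := by
    rw [← hrinv, le_div_iff₀ hr0] at hν
    linarith
  have hGr : (2 * G / b : ℝ) ^ 2 / v ≤ r := by
    apply le_of_eq
    rw [hvR, hr]
    field_simp
    ring
  have hτ : (b / n : ℝ) * (1 + 1 / r) ≤ Real.exp (-α) := by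
    have hpos : 0 < μ * n ^ 3 * ε / (5 * b ^ 3 * T * α + μ * b * n ^ 2 * ε) := by positivity
    have h1 := (Real.le_log_iff_exp_le hpos).1 hα
    have h2 : (b / n : ℝ) * (1 + 1 / r) =
        (μ * n ^ 3 * ε / (5 * b ^ 3 * T * α + μ * b * n ^ 2 * ε))⁻¹ := by
      rw [hrinv, inv_div]
      field_simp
      ring
    rw [h2, Real.exp_neg]
    exact inv_anti₀ (Real.exp_pos _) h1
  have hbn' : b < n := by
    have : Real.exp (-α) < 1 := Real.exp_lt_one_iff.2 (by linarith)
    have : 0 < (b / n : ℝ) * (1 / r) := by positivity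
    have : (b / n : ℝ) < 1 := by linarith
    rw [div_lt_one hnR] at this
    exact_mod_cast this
  obtain ⟨i₀, -, hi₀⟩ := hadj
  have hS : ∀ j, j ≠ i₀ → S j = S' j := fun j hj => by
    by_contra hne
    exact hj (hi₀ j hne)
  have hconj := Real.HolderConjugate.conjExponent hα1
  have hdom := momentDominated_iterateLaw hconj.symm.pos
    (fun η w => momentDominated_stepLaw hloss hv0 hb hbn' hconj hr0 hr1 hτ hGr hS σ η w) η w₀ T
  have hc : (ENNReal.ofReal (Real.exp (5 * α * (α - 1) * ((b / n : ℝ) ^ 2 * r))) ^ (1 / α)) ^ T =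
      ENNReal.ofReal (Real.exp ((α - 1) * (μ * ε))) ^ (1 / α) := by
    rw [← ENNReal.rpow_natCast, ← ENNReal.rpow_mul, mul_comm (1 / α), ENNReal.rpow_mul,
      ENNReal.rpow_natCast, ← ENNReal.ofReal_pow (Real.exp_pos _).le, ← Real.exp_nat_mul]
    congr 3
    rw [hr]
    field_simp
  rw [hc] at hdom
  have := hdom.measure_le hconj hδ hO
  rwa [hκ] at this
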